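/- Let $n\ge 1$ and let $h_1\ge 0$, $h_2,\dots,h_n\ge 1$, $v_1,\dots,v_{n-1}\ge 1$ be integers. Let $L=(\Lambda_1,\Lambda_2)=(2h_n,v_{n-1},2h_{n-1},\dots,2h_2,v_1,2h_1)$ be the standard rational Legendrian link in $\mathcal J^1(S^1)=T^*S^1\times\mathbb R$ (contact form $dz-y\,dx$), given by the following front in the $xz$-cylinder $S^1\times\mathbb R$. It is the closure of a front tangle with two left ends and two right ends. The tangle $(2h_n)$ consists of two strands, each a graph over the interval, crossing each other $2h_n$ times. The tangle $(2h_n,\dots,2h_i,v_{i-1},2h_{i-1})$ is obtained from $(2h_n,\dots,2h_i)$ by first adding $v_{i-1}$ vertical crossings one after another, where each addition turns the lower left end back to the right by a left cusp, turns the lower right end back to the left by a right cusp, and lets the two resulting strands cross below the tangle, and then adding $2h_{i-1}$ successive crossings of the two right ends. $\Lambda_2$ is the component containing the upper left end, $\Lambda_1$ the other one. Resolve this front to a Lagrangian ($xy$-) projection: at each front crossing the strand of lesser slope becomes the overstrand, left cusps are smoothed, each right cusp is replaced by a small loop with one crossing (again with the overstrand of lesser slope), and a tangle with two crossings is appended on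 the right, in which the upper strand passes down over the lower strand and then back up over it. Its crossings (the vertices) generate the Chekanov–Eliashberg differential algebra $\mathbb A$ over $\mathbb Z/2$, the free unital algebra on the vertices, where $\partial a$ is the sum, over all immersed disks with boundary on the diagram and convex corners, exactly one of them positive and located at $a$, of the words formed by their negative corners in counterclockwise order, and $\partial$ is extended by the Leibniz rule. (The left and right quadrants of a crossing are positive and the upper and lower ones negative if the overstrand has lesser slope; at the last crossing, where the overstrand has greater slope, it is the other way round.) The degree of $a$ is $c(\gamma^u)-c(\gamma^o)$, minus $1$ at that last crossing, where $\gamma^u,\gamma^o$ are paths along the link from $a$, starting on the understrand and on the overstrand respectively, to the leftmost points of the components, and $c$ counts cusps traversed upwards minus cusps traversed downwards. Let $\mathbb A^{j_1j_2}$ contain the vertices whose overstrand lies in $\Lambda_{j_1}$ and whose understrand lies in $\Lambda_{j_2}$. An augmentation of a component $\Lambda_j$ is a unital algebra map from its own differential algebra (as a knot) to $\mathbb Z/2$ that vanishes on the image of $\partial$ and in nonzero degrees; an augmentation of $L$ is a $\mathbb Z/2$-valued function $\varepsilon$ on the vertices given by augmentations of $\Lambda_1$ and $\Lambda_2$ on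 the vertices in $\mathbb A^{11}$ and $\mathbb A^{22}$, and by $0$ on all other vertices. Let $\partial^1_\varepsilon a$ be the linear part of $\partial a$ after replacing each vertex $b$ by $b+\varepsilon(b)$, let $V_k^{j_1j_2}$ be the $\mathbb Z/2$-vector space spanned by the vertices in $\mathbb A^{j_1j_2}$ of degree $k$, and put $$\chi^{j_1j_2}_\varepsilon(\lambda)=\sum_{k\in\mathbb Z}\dim\frac{\ker(\partial^1_\varepsilon:V_k^{j_1j_2}\to V_{k-1}^{j_1j_2})}{\operatorname{im}(\partial^1_\varepsilon:V_{k+1}^{j_1j_2}\to V_k^{j_1j_2})}\,\lambda^k,\qquad \chi^+=\chi^{12},\quad \chi^-=\chi^{21}.$$ **Theorem.** For each vertex, the degree is well defined and there are finitely many immersed disks as above (up to reparametrization), so that all of this makes sense. The link $L$ has a unique augmentation, and its split Poincaré–Chekanov polynomials are $$\chi^+(\lambda)[L]=h_1+h_2\lambda^{v_1}+h_3\lambda^{v_1+v_2}+\dots+h_n\lambda^{v_1+\dots+v_{n-1}},$$ $$\chi^-(\lambda)[L]=\begin{cases}\chi^+(\lambda^{-1})[L], & h_1\ge 1,\\ \lambda^{-1}+1+\chi^+(\lambda^{-1})[L],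 & h_1=0.\end{cases}$$ -/

import Mathlib

namespace LegendrianSolidTorus

/-! ### Fronts and their resolutions

A front in `S¹ × ℝ` in general position is cut by vertical lines into slabs containing one
singularity each, and is recorded as the list of these singularities from left to right; the right
end of the list is glued to its left end. On each vertical line the strands are numbered
`0, 1, 2, …` from bottom to top. -/

/-- The singularities of a front. `leftCusp k` creates the strands `k` (lower branch) and `k + 1`
(upper branch), `crossing k` is a crossing of the strands `k` and `k + 1`, and `rightCusp k` joins
the strands `k` and `k + 1`. -/
inductive FrontLetter where
  | leftCusp (k : ℕ)
  | crossing (k : ℕ)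
  | rightCusp (k : ℕ)

/-- Move a singularity up by `m` strands. -/
def FrontLetter.shift (m : ℕ) : FrontLetter → FrontLetter
  | .leftCusp k => .leftCusp (k + m)
  | .crossing k => .crossing (k + m)
  | .rightCusp k => .rightCusp (k + m)

/-- The two kinds of crossings in a Lagrangian projection drawn in the `xy`-plane: at a `normal`
crossing the overstrand is the strand of lesser slope, at a `special` crossing it is the strand of
greater slope. -/
inductive CrossingType where
  | normal
  | special

/-- The elementary pieces of a Lagrangian projection in `S¹ × ℝ`: a crossing of the strands
`k` and `k + 1`, a smooth arc `⊂` creating the strands `k` and `k + 1` (`cup`), and a smooth arc `⊃`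
joining the strands `k` and `k + 1` (`cap`). -/
inductive Letter where
  | cross (k : ℕ) (ty : CrossingType)
  | cup (k : ℕ)
  | cap (k : ℕ)

/-- Whether a letter is a crossing. -/
def Letter.isCross : Letter → Bool
  | .cross _ _ => true
  | _ => false

/-- Resolution of one singularity of a front: crossings become normal crossings, left cusps become
smooth arcs, and a right cusp becomes a small loop, that is, a normal crossing followed by a smooth
arc. -/
def FrontLetter.resolve : FrontLetter → List Letter
  | .leftCusp k => [.cup k]
  | .crossing k => [.cross k .normal]
  | .rightCusp k => [.cross k .normal, .cap k]

/-- The transition tangle `T_n` on `n` strands. It is obtained from `T_{n-1}` by letting the top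
strand pass down over all the other strands (normal crossings), and then back up over all of them
(special crossings). -/
def transition : ℕ → List Letter
  | 0 => []
  | n + 1 => transition n ++ (List.range n).reverse.map (fun k => .cross k .normal) ++
      (List.range n).map (fun k => .cross k .special)

/-- The resolution of a front that has two strands over the point `0 ∈ S¹`: resolve each
singularity, and append `T_2` on the right. -/
def resolution (Z : List FrontLetter) : List Letter :=
  Z.flatMap FrontLetter.resolve ++ transition 2

/-! ### The standard rational links -/

/-- Vertical addition of one crossing below a front tangle `T` with two strands at each end. The
lower left end of `T` is turned to the right by a left cusp, the lower right end of `T` is turned to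
the left by a right cusp, and the two resulting strands cross below `T`. -/
def verticalAdd (T : List FrontLetter) : List FrontLetter :=
  [.leftCusp 1] ++ T.map (FrontLetter.shift 2) ++ [.crossing 0, .rightCusp 1]

/-- Horizontal addition of `m` crossings of the two right ends of a front tangle. -/
def horizontalAdd (m : ℕ) (T : List FrontLetter) : List FrontLetter :=
  T ++ List.replicate m (.crossing 0)

/-- The front tangle `(2h_{i+m}, v_{i+m-1}, …, 2h_{i+1}, v_i, 2h_i)`. -/
def standardTangle (h v : ℕ → ℕ) : ℕ → ℕ → List FrontLetter
  | i, 0 => horizontalAdd (2 * h i) []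
  | i, m + 1 => horizontalAdd (2 * h i) (verticalAdd^[v i] (standardTangle h v (i + 1) m))

/-- The (resolved) standard rational link `(2h_n, v_{n-1}, …, 2h_2, v_1, 2h_1)`, `n ≥ 1`. -/
def standardLink (n : ℕ) (h v : ℕ → ℕ) : List Letter :=
  resolution (standardTangle h v 1 (n - 1))

/-! ### Strands, components and gradings

From now on a Lagrangian projection is a list `W` of letters, read cyclically. Column `c` is the
vertical line on the left of the `c`-th letter. The point `(c, i)` is the point of the `i`-th strand
(from the bottom) in column `c`. -/

/-- The column on the right of the `s`-th letter. -/
def nextCol (W : List Letter) (s : ℕ) : ℕ := (s + 1) % W.length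

/-- The transposition of `k` and `k + 1`. -/
def swapAt (k i : ℕ) : ℕ := if i = k then k + 1 else if i = k + 1 then k else i

/-- The new number of strand `i` after two strands have been inserted in positions `k`, `k + 1`. -/
def liftAt (k i : ℕ) : ℕ := if i < k then i else i + 2

/-- The strand `i` on the left of the letter continues to the strand `i'` on its right. -/
def Through : Letter → ℕ → ℕ → Prop
  | .cross k _, i, i' => i' = swapAt k i
  | .cup k, i, i' => i' = liftAt k i
  | .cap k, i, i' => i = liftAt k i'

/-- `CuspPath W p q m`: there is a path along the link from `p` to `q` whose number of up cusps
minus number of down cusps is `m`. In the resolution, a left or right cusp of the front is traversed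
upwards exactly when the corresponding smooth arc is traversed clockwise: from the lower to the
upper strand for a `cup`, and from the upper to the lower strand for a `cap` (because of the crossing
that precedes it, the upper strand there continues the lower branch of the right cusp). -/
inductive CuspPath (W : List Letter) : ℕ × ℕ → ℕ × ℕ → ℤ → Prop where
  | refl (p : ℕ × ℕ) : CuspPath W p p 0
  | goRight {s i i' : ℕ} {q : ℕ × ℕ} {m : ℤ} (ℓ : Letter) (hs : W[s]? = some ℓ)
      (hi : Through ℓ i i') (γ : CuspPath W (nextCol W s, i') q m) : CuspPath W (s, i) q m
  | goLeft {s i i' : ℕ} {q : ℕ × ℕ} {m : ℤ} (ℓ : Letter) (hs : W[s]? = some ℓ)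
      (hi : Through ℓ i i') (γ : CuspPath W (s, i) q m) : CuspPath W (nextCol W s, i') q m
  | cupUp {s k : ℕ} {q : ℕ × ℕ} {m : ℤ} (hs : W[s]? = some (.cup k))
      (γ : CuspPath W (nextCol W s, k + 1) q m) : CuspPath W (nextCol W s, k) q (m + 1)
  | cupDown {s k : ℕ} {q : ℕ × ℕ} {m : ℤ} (hs : W[s]? = some (.cup k))
      (γ : CuspPath W (nextCol W s, k) q m) : CuspPath W (nextCol W s, k + 1) q (m - 1)
  | capUp {s k : ℕ} {q : ℕ × ℕ} {m : ℤ} (hs : W[s]? = some (.cap k))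
      (γ : CuspPath W (s, k) q m) : CuspPath W (s, k + 1) q (m + 1)
  | capDown {s k : ℕ} {q : ℕ × ℕ} {m : ℤ} (hs : W[s]? = some (.cap k))
      (γ : CuspPath W (s, k + 1) q m) : CuspPath W (s, k) q (m - 1)

/-- The base points: the leftmost points of the two components. `basePoint 0` is the bottom
strand and lies on `Λ₁`, `basePoint 1` is the top strand and lies on `Λ₂`. -/
def basePoint (j : Fin 2) : ℕ × ℕ := (0, j)

/-- The point `p` lies on the component of the base point `j`. -/
def OnComponent (W : List Letter) (p : ℕ × ℕ) (j : Fin 2) : Prop :=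
  ∃ m, CuspPath W p (basePoint j) m

/-- The vertices of a Lagrangian projection, which generate its algebra: the crossings.
(For a resolution these are the crossings of the front, the crossings of the transition tangle, and
one crossing for each right cusp of the front.) -/
abbrev Vertex (W : List Letter) : Type := {s : Fin W.length // (W.get s).isCross = true}

/-- The vertex given by the `s`-th letter. -/
def mkVertex {W : List Letter} {s k : ℕ} {ty : CrossingType}
    (hs : W[s]? = some (.cross k ty)) : Vertex W :=
  ⟨⟨s, (List.getElem?_eq_some_iff.mp hs).1⟩, by
    have h := (List.getElem?_eq_some_iff.mp hs).2
    simp only [List.get_eq_getElem, h, Letter.isCross]⟩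

/-- The point in which the overstrand of a crossing enters from the left. -/
def overPoint {W : List Letter} (a : Vertex W) : ℕ × ℕ :=
  match W.get a.1 with
  | .cross k .normal => (a.1, k + 1)
  | .cross k .special => (a.1, k)
  | _ => (a.1, 0)

/-- The point in which the understrand of a crossing enters from the left. -/
def underPoint {W : List Letter} (a : Vertex W) : ℕ × ℕ :=
  match W.get a.1 with
  | .cross k .normal => (a.1, k)
  | .cross k .special => (a.1, k + 1)
  | _ => (a.1, 0)

/-- The correction `1` in the degree of special crossings. -/
def specialShift {W : List Letter} (a : Vertex W) : ℤ :=
  match W.get a.1 with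
  | .cross _ .special => 1
  | _ => 0

/-- The generator `a` belongs to `𝔸^{j₁ j₂}`: its overstrand is part of the component `j₁` and its
understrand is part of the component `j₂`. -/
def InSplit {W : List Letter} (j₁ j₂ : Fin 2) (a : Vertex W) : Prop :=
  OnComponent W (overPoint a) j₁ ∧ OnComponent W (underPoint a) j₂

/-- `d = c(γᵘ) - c(γᵒ)`, or `d = c(γᵘ) - c(γᵒ) - 1` for special crossings, for some capping paths
`γᵒ`, `γᵘ` from `a` along the overstrand and the understrand to base points. (At the crossing of a
right cusp this gives `1`.) -/
def HasDegree {W : List Letter} (a : Vertex W) (d : ℤ) : Prop :=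
  ∃ (j₁ j₂ : Fin 2) (co cu : ℤ), CuspPath W (overPoint a) (basePoint j₁) co ∧
    CuspPath W (underPoint a) (basePoint j₂) cu ∧ d = cu - co - specialShift a

/-- The degree of a generator. -/
noncomputable def degree {W : List Letter} (a : Vertex W) : ℤ := Classical.epsilon (HasDegree a)

/-! ### Immersed disks

We encode immersions of the disk into `S¹ × ℝ`, up to reparametrization, whose boundary runs along
the link and is smooth except at convex corners at crossings. The preimages of the columns cut such a
disk along arcs that are mapped to vertical segments between two strands `i < j` of a column. The
connected components of what remains are mapped to single slabs, and only the following pieces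
occur:
* strips from a left edge to a right edge, whose lower and upper boundary each follow one strand; at
  a crossing one of the two may turn instead, at a convex corner whose quadrant is the upper one (for
  the lower boundary) or the lower one (for the upper boundary);
* end pieces with one edge: the inside of a `cup` or a `cap`, or the left or right quadrant of a
  crossing;
* pieces with three edges lying around the outside of a `cup` or a `cap`.
Each arc separates the disk, so that the pieces form a finite tree; conversely, every finite tree of
pieces that match along their edges is such a disk.

At a normal crossing the left and right quadrants are positive and the upper and lower quadrants are
negative; at a special crossing it is the other way round. The disks that are counted have exactly one
positive corner. -/

/-- On which side of its cutting edge a half disk lies. -/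
inductive Side where
  | left
  | right

/-- `HalfDisk W σ c i j` is the type of immersed half disks that are bounded by the segment between
the strands `i < j` of column `c`, lie on the side `σ` of this segment (near the segment), and have
negative corners only. -/
inductive HalfDisk (W : List Letter) : Side → ℕ → ℕ → ℕ → Type where
  /-- strips -/
  | stripL {s i j i' j' : ℕ} (ℓ : Letter) (hs : W[s]? = some ℓ) (hi : Through ℓ i i')
      (hj : Through ℓ j j') (hij : i < j) (hij' : i' < j') (d : HalfDisk W .left s i j) :
      HalfDisk W .left (nextCol W s) i' j'
  | stripR {s i j i' j' : ℕ} (ℓ : Letter) (hs : W[s]? = some ℓ) (hi : Through ℓ i i')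
      (hj : Through ℓ j j') (hij : i < j) (hij' : i' < j')
      (d : HalfDisk W .right (nextCol W s) i' j') : HalfDisk W .right s i j
  /-- strips with a corner of their lower boundary, in the upper quadrant of a crossing -/
  | lowerCornerL {s k j : ℕ} (hs : W[s]? = some (.cross k .normal)) (hj : k + 1 < j)
      (d : HalfDisk W .left s (k + 1) j) : HalfDisk W .left (nextCol W s) (k + 1) j
  | lowerCornerR {s k j : ℕ} (hs : W[s]? = some (.cross k .normal)) (hj : k + 1 < j)
      (d : HalfDisk W .right (nextCol W s) (k + 1) j) : HalfDisk W .right s (k + 1) j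
  /-- strips with a corner of their upper boundary, in the lower quadrant of a crossing -/
  | upperCornerL {s k i : ℕ} (hs : W[s]? = some (.cross k .normal)) (hi : i < k)
      (d : HalfDisk W .left s i k) : HalfDisk W .left (nextCol W s) i k
  | upperCornerR {s k i : ℕ} (hs : W[s]? = some (.cross k .normal)) (hi : i < k)
      (d : HalfDisk W .right (nextCol W s) i k) : HalfDisk W .right s i k
  /-- end pieces at the right or left quadrant of a crossing -/
  | endCornerL {s k : ℕ} (hs : W[s]? = some (.cross k .special)) :
      HalfDisk W .left (nextCol W s) k (k + 1)
  | endCornerR {s k : ℕ} (hs : W[s]? = some (.cross k .special)) : HalfDisk W .right s k (k + 1)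
  /-- end pieces inside a `cup` or `cap` -/
  | endCup {s k : ℕ} (hs : W[s]? = some (.cup k)) : HalfDisk W .left (nextCol W s) k (k + 1)
  | endCap {s k : ℕ} (hs : W[s]? = some (.cap k)) : HalfDisk W .right s k (k + 1)
  /-- the piece around a `cup` with left edge `(i, j)` and right edges `(i, k)`, `(k + 1, j + 2)`,
  seen from its lower right, its upper right, and its left edge -/
  | cupLower {s k i j : ℕ} (hs : W[s]? = some (.cup k)) (hi : i < k) (hj : k ≤ j)
      (d : HalfDisk W .left s i j) (e : HalfDisk W .right (nextCol W s) (k + 1) (j + 2)) :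
      HalfDisk W .left (nextCol W s) i k
  | cupUpper {s k i j : ℕ} (hs : W[s]? = some (.cup k)) (hi : i < k) (hj : k ≤ j)
      (d : HalfDisk W .left s i j) (e : HalfDisk W .right (nextCol W s) i k) :
      HalfDisk W .left (nextCol W s) (k + 1) (j + 2)
  | cupFork {s k i j : ℕ} (hs : W[s]? = some (.cup k)) (hi : i < k) (hj : k ≤ j)
      (d : HalfDisk W .right (nextCol W s) i k)
      (e : HalfDisk W .right (nextCol W s) (k + 1) (j + 2)) : HalfDisk W .right s i j
  /-- the piece around a `cap` with left edges `(i, k)`, `(k + 1, j + 2)` and right edge `(i, j)`,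
  seen from its lower left, its upper left, and its right edge -/
  | capLower {s k i j : ℕ} (hs : W[s]? = some (.cap k)) (hi : i < k) (hj : k ≤ j)
      (d : HalfDisk W .right (nextCol W s) i j) (e : HalfDisk W .left s (k + 1) (j + 2)) :
      HalfDisk W .right s i k
  | capUpper {s k i j : ℕ} (hs : W[s]? = some (.cap k)) (hi : i < k) (hj : k ≤ j)
      (d : HalfDisk W .right (nextCol W s) i j) (e : HalfDisk W .left s i k) :
      HalfDisk W .right s (k + 1) (j + 2)
  | capJoin {s k i j : ℕ} (hs : W[s]? = some (.cap k)) (hi : i < k) (hj : k ≤ j)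
      (d : HalfDisk W .left s i k) (e : HalfDisk W .left s (k + 1) (j + 2)) :
      HalfDisk W .left (nextCol W s) i j

/-- The corners of a half disk in counterclockwise order along its boundary, from one end of its
cutting edge to the other. -/
def HalfDisk.word {W : List Letter} {σ : Side} {c i j : ℕ} :
    HalfDisk W σ c i j → List (Vertex W)
  | .stripL _ _ _ _ _ _ d => d.word
  | .stripR _ _ _ _ _ _ d => d.word
  | .lowerCornerL hs _ d => d.word ++ [mkVertex hs]
  | .lowerCornerR hs _ d => mkVertex hs :: d.word
  | .upperCornerL hs _ d => mkVertex hs :: d.word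
  | .upperCornerR hs _ d => d.word ++ [mkVertex hs]
  | .endCornerL hs => [mkVertex hs]
  | .endCornerR hs => [mkVertex hs]
  | .endCup _ => []
  | .endCap _ => []
  | .cupLower _ _ _ d e => e.word ++ d.word
  | .cupUpper _ _ _ d e => d.word ++ e.word
  | .cupFork _ _ _ d e => d.word ++ e.word
  | .capLower _ _ _ d e => d.word ++ e.word
  | .capUpper _ _ _ d e => e.word ++ d.word
  | .capJoin _ _ _ d e => e.word ++ d.word

/-- `Disk W a` is the type of immersed disks with exactly one positive corner, at the vertex `a`.
The positive corner fills the left or right quadrant of a normal crossing, or the upper or lower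
quadrant of a special crossing. In the last two cases the two columns next to the crossing cut the
disk into the strip that contains the corner and two half disks. -/
inductive Disk (W : List Letter) : Vertex W → Type where
  | leftQuadrant {s k : ℕ} (hs : W[s]? = some (.cross k .normal))
      (d : HalfDisk W .left s k (k + 1)) : Disk W (mkVertex hs)
  | rightQuadrant {s k : ℕ} (hs : W[s]? = some (.cross k .normal))
      (d : HalfDisk W .right (nextCol W s) k (k + 1)) : Disk W (mkVertex hs)
  | upperQuadrant {s k j : ℕ} (hs : W[s]? = some (.cross k .special)) (hj : k + 1 < j)
      (d : HalfDisk W .left s (k + 1) j) (e : HalfDisk W .right (nextCol W s) (k + 1) j) :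
      Disk W (mkVertex hs)
  | lowerQuadrant {s k i : ℕ} (hs : W[s]? = some (.cross k .special)) (hi : i < k)
      (d : HalfDisk W .left s i k) (e : HalfDisk W .right (nextCol W s) i k) :
      Disk W (mkVertex hs)

/-- The negative corners of a disk, in counterclockwise order, starting just after its positive
corner. -/
def Disk.word {W : List Letter} {a : Vertex W} : Disk W a → List (Vertex W)
  | .leftQuadrant _ d => d.word
  | .rightQuadrant _ d => d.word
  | .upperQuadrant _ _ d e => e.word ++ d.word
  | .lowerQuadrant _ _ d e => d.word ++ e.word

/-! ### The differential algebra, augmentations, and split Poincaré–Chekanov polynomials -/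

/-- The extension, by the Leibniz rule `∂(xy) = x ∂y + (∂x) y`, of a map defined on the generators of
a free algebra over `ℤ/2`. -/
noncomputable def leibniz {X : Type} (δ : X → FreeAlgebra (ZMod 2) X)
    (x : FreeAlgebra (ZMod 2) X) : FreeAlgebra (ZMod 2) X :=
  (FreeAlgebra.lift (ZMod 2)
    (fun a => (TrivSqZeroExt.inl (FreeAlgebra.ι (ZMod 2) a) + TrivSqZeroExt.inr (δ a) :
      TrivSqZeroExt (FreeAlgebra (ZMod 2) X) (FreeAlgebra (ZMod 2) X))) x).snd

/-- The differential `∂a` of a generator in the algebra of the link: the sum of the words of all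
immersed disks with positive corner at `a`. -/
noncomputable def boundary {W : List Letter} (a : Vertex W) : FreeAlgebra (ZMod 2) (Vertex W) :=
  ∑ᶠ d : Disk W a, (d.word.map (FreeAlgebra.ι (ZMod 2))).prod

/-- The vertices of the component `j`, considered as a knot. -/
abbrev KnotVertex (W : List Letter) (j : Fin 2) : Type := {a : Vertex W // InSplit j j a}

/-- The differential of a generator in the algebra of the component `j`, considered as a knot: the
sum over the disks with boundary on this component, that is, the disks all of whose corners are
crossings of this component with itself. -/
noncomputable def knotBoundary {W : List Letter} {j : Fin 2} (a : KnotVertex W j) :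
    FreeAlgebra (ZMod 2) (KnotVertex W j) :=
  ∑ᶠ d : {d : Disk W a.1 // ∀ b ∈ d.word, InSplit j j b},
    ((d.1.word.attachWith (InSplit j j) d.2).map (FreeAlgebra.ι (ZMod 2))).prod

/-- Augmentations of the component `j`, considered as a knot: algebra maps `ε` to `ℤ/2` with
`ε ∘ ∂ = 0` that vanish in nonzero degrees. -/
def IsKnotAugmentation {W : List Letter} {j : Fin 2}
    (ε : FreeAlgebra (ZMod 2) (KnotVertex W j) →ₐ[ZMod 2] ZMod 2) : Prop :=
  (∀ x, ε (leibniz knotBoundary x) = 0) ∧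
    ∀ w : List (KnotVertex W j), (w.map fun a => degree a.1).sum ≠ 0 →
      ε (w.map (FreeAlgebra.ι (ZMod 2))).prod = 0

/-- Augmentations of the link: augmentations of both components, extended by zero to the crossings
between different components. -/
def IsAugmentation {W : List Letter} (ε : Vertex W → ZMod 2) : Prop :=
  ∃ ε' : ∀ j : Fin 2, FreeAlgebra (ZMod 2) (KnotVertex W j) →ₐ[ZMod 2] ZMod 2,
    (∀ j, IsKnotAugmentation (ε' j)) ∧
    (∀ (j : Fin 2) (a : KnotVertex W j), ε a.1 = ε' j (FreeAlgebra.ι (ZMod 2) a)) ∧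
    ∀ a : Vertex W, (∀ j, ¬ InSplit j j a) → ε a = 0

/-- The coefficient of the generator `b` in `∂¹_ε a`: replace each generator `c` by `c + ε(c)` in
`∂a`, and take the coefficient of the word `b`. -/
noncomputable def linearCoeff {W : List Letter} (ε : Vertex W → ZMod 2) (b a : Vertex W) : ZMod 2 :=
  (FreeAlgebra.basisFreeMonoid (ZMod 2) (Vertex W)).repr
    (FreeAlgebra.lift (ZMod 2)
      (fun c => FreeAlgebra.ι (ZMod 2) c + algebraMap (ZMod 2) _ (ε c)) (boundary a))
    (FreeMonoid.of b)

/-- The generators of degree `k` in `𝔸^{j₁ j₂}`. -/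
abbrev SplitVertex (W : List Letter) (j₁ j₂ : Fin 2) (k : ℤ) : Type :=
  {a : Vertex W // InSplit j₁ j₂ a ∧ degree a = k}

open Classical in
/-- The part `V_k^{j₁ j₂} → V_l^{j₁ j₂}` of the linearized differential `∂¹_ε`. -/
noncomputable def linearDifferential {W : List Letter} (ε : Vertex W → ZMod 2) (j₁ j₂ : Fin 2)
    (k l : ℤ) : (SplitVertex W j₁ j₂ k → ZMod 2) →ₗ[ZMod 2] (SplitVertex W j₁ j₂ l → ZMod 2) :=
  (Matrix.of fun b a => linearCoeff ε b.1 a.1 :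
    Matrix (SplitVertex W j₁ j₂ l) (SplitVertex W j₁ j₂ k) (ZMod 2)).mulVecLin

/-- `β_k^{j₁ j₂}(ε)`, the dimension of the kernel of `V_k → V_{k-1}` modulo the image of
`V_{k+1} → V_k`. -/
noncomputable def betti {W : List Letter} (ε : Vertex W → ZMod 2) (j₁ j₂ : Fin 2) (k : ℤ) : ℕ :=
  Module.finrank (ZMod 2)
    (LinearMap.ker (linearDifferential ε j₁ j₂ k (k - 1)) ⧸
      (LinearMap.range (linearDifferential ε j₁ j₂ (k + 1) k)).submoduleOf
        (LinearMap.ker (linearDifferential ε j₁ j₂ k (k - 1))))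

open LaurentPolynomial in
/-- The split Poincaré–Chekanov polynomial `χ_ε^{j₁ j₂}(λ) = ∑_k β_k^{j₁ j₂}(ε) λ^k`. -/
noncomputable def chekanovPoly {W : List Letter} (ε : Vertex W → ZMod 2) (j₁ j₂ : Fin 2) :
    LaurentPolynomial ℤ :=
  ∑ᶠ k : ℤ, C (betti ε j₁ j₂ k : ℤ) * T k

/-- `χ⁺ = χ^{12}`. -/
noncomputable def chiPlus {W : List Letter} (ε : Vertex W → ZMod 2) : LaurentPolynomial ℤ :=
  chekanovPoly ε 0 1

/-- `χ⁻ = χ^{21}`. -/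
noncomputable def chiMinus {W : List Letter} (ε : Vertex W → ZMod 2) : LaurentPolynomial ℤ :=
  chekanovPoly ε 1 0

end LegendrianSolidTorus

/-! Call the number of vertical crossings still to come the level; it is also the number of arcs `⊂`
still open. The twists `h_i` sit in level `v_1 + … + v_{i-1}` (`standardTangle_eq_frontStandard`).
In level `p` there are `2 * p + 2` strands, and at its start the top one is `Λ₂`. The cusp count is
a potential on the strands, so a full twist in level `p` has one crossing of degree `p` in `𝔸¹²` and
one of degree `-p` in `𝔸²¹`. The only other mixed crossings are those of the transition tangle, both
in `𝔸²¹`, of degrees `0` and `-1`. Hence χ⁺ and χ⁻ are generator counts, up to the ranks of the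
linearized differential.

The disks can be counted because the two strands that meet at an arc `⊃`, or at the special
crossing, have just crossed each other: no right half disk extends further to the left
(`right_halfDisk`). So everything reduces to left half disks, which propagate from left to right.
Column zero has only one of them, at the special crossing (`left_halfDisk_zero`), and this breaks
the circle. Counted with weights in a commutative ring, left half disks form a matrix indexed by
pairs of strands, updated at every letter. Assume characteristic two, weight `0` on loops and `1` on
vertical crossings, and mixed weights in a square-zero ideal. Then only a few matrices occur
(`siteState`). At the start of level `p` the entries are `1` for the open arcs, the weight `β` of
the special crossing between the bottom and the top strand, and a sum `T` of weights of odd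
crossings between strand `2 * p - 1` and the top strand. Each arc `⊃` produces `T` twice and so
removes it; a crossing in level zero kills `β`.

This count is used twice. Over `ℤ/2` it gives the augmentation: loops have degree `1` and must go to
`0`, and the differential of a loop then forces the vertical crossing to go to `1` (`eq_linkAug`).
Over the dual numbers it gives the linearized differential (`linearCoeff_eq`). This vanishes on
`𝔸¹²`. In `𝔸²¹`, the crossing `last` receives the special crossing from both sides. Without twists
in level zero the two contributions cancel and the differential is zero; otherwise only one
survives, and the differential has rank one from degree `0` to degree `-1`, which removes `λ⁻¹ + 1`.
-/

namespace LegendrianSolidTorus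

/-! ### The standard links as cyclic words of sites -/

/-- The places of the resolution of a standard link, with the number `p` of arcs `⊂` that are still
open. At level `p`, `odd p` and `even p` are the crossings of the two top strands, and `vert p`,
`loop p`, `cap p` lead from level `p + 1` to level `p`; `last` and `special` form the transition
tangle. -/
inductive Site where
  | cup (q : ℕ)
  | odd (p : ℕ)
  | even (p : ℕ)
  | vert (p : ℕ)
  | loop (p : ℕ)
  | cap (p : ℕ)
  | last
  | special

namespace Site

/-- The letter of a site. -/
def letter : Site → Letter
  | cup q => .cup (2 * q + 1)
  | odd p => .cross (2 * p) .normal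
  | even p => .cross (2 * p) .normal
  | vert p => .cross (2 * p) .normal
  | loop p => .cross (2 * p + 1) .normal
  | cap p => .cap (2 * p + 1)
  | last => .cross 0 .normal
  | special => .cross 0 .special

/-- The sites that may follow the arcs, the twists, or the caps that end in level `p`. -/
def LevelStart (p : ℕ) (κ : Site) : Prop :=
  κ = odd p ∨ (∃ r, p = r + 1 ∧ κ = vert r) ∨ (p = 0 ∧ κ = last)

/-- The relation between neighbouring sites. -/
def Next : Site → Site → Prop
  | cup q, κ => κ = cup (q + 1) ∨ LevelStart (q + 1) κ
  | odd p, κ => κ = even p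
  | even p, κ => LevelStart p κ
  | vert p, κ => κ = loop p
  | loop p, κ => κ = cap p
  | cap p, κ => LevelStart p κ
  | last, κ => κ = special
  | special, κ => κ = cup 0 ∨ LevelStart 0 κ

end Site

/-- The diagram given by a list of sites. -/
abbrev siteWord (K : List Site) : List Letter := K.map Site.letter

/-- The list of sites closes up to a diagram in `S¹ × ℝ` whose base point is at `special`. -/
structure IsClosed (K : List Site) : Prop where
  next : ∀ s κ, K[s]? = some κ → ∃ κ', K[nextCol (siteWord K) s]? = some κ' ∧ κ.Next κ'
  special_iff : ∀ s, K[s]? = some .special ↔ s + 1 = K.length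
  pos : 0 < K.length

/-- `g` full twists in level `p`. -/
def twistSites (p : ℕ) : ℕ → List Site
  | 0 => []
  | g + 1 => .odd p :: .even p :: twistSites p g

/-- The levels `p, …, 0`, with `G i` full twists in level `i`. -/
def levelSites (G : ℕ → ℕ) : ℕ → List Site
  | 0 => twistSites 0 (G 0)
  | p + 1 => twistSites (p + 1) (G (p + 1)) ++ .vert p :: .loop p :: .cap p :: levelSites G p

/-- The sites of the link with `N` vertical crossings and `G i` full twists in level `i`. -/
def sites (G : ℕ → ℕ) (N : ℕ) : List Site :=
  (List.range N).map .cup ++ (levelSites G N ++ [.last, .special])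

/-- A block without twists is empty, and its first site is then that of what follows; so the
induction carries the condition on the head along with the chain condition. -/
theorem next_append_twistSites {p : ℕ} {r : List Site} (hr : r.IsChain Site.Next)
    (h0 : ∀ κ ∈ r.head?, Site.LevelStart p κ) (g : ℕ) :
    (twistSites p g ++ r).IsChain Site.Next ∧
      ∀ κ ∈ (twistSites p g ++ r).head?, Site.LevelStart p κ := by
  induction g with
  | zero => exact ⟨hr, h0⟩
  | succ g ih =>
    refine ⟨?_, by simp [twistSites, Site.LevelStart]⟩
    simp only [twistSites, List.cons_append, List.isChain_cons_cons]
    refine ⟨rfl, ?_⟩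
    rw [List.isChain_cons]
    exact ⟨fun κ hκ => ih.2 κ hκ, ih.1⟩

theorem next_levelSites (G : ℕ → ℕ) (p : ℕ) :
    (levelSites G p ++ [Site.last, Site.special]).IsChain Site.Next ∧
      ∀ κ ∈ (levelSites G p ++ [Site.last, Site.special]).head?, Site.LevelStart p κ := by
  induction p with
  | zero =>
    apply next_append_twistSites
    · simp [Site.Next]
    · simp [Site.LevelStart]
  | succ p ih =>
    simp only [levelSites, List.append_assoc]
    apply next_append_twistSites
    · simp only [List.cons_append, List.isChain_cons_cons]
      refine ⟨rfl, rfl, ?_⟩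
      rw [List.isChain_cons]
      exact ⟨fun κ hκ => ih.2 κ hκ, ih.1⟩
    · simp [Site.LevelStart]

theorem next_cups {N : ℕ} {r : List Site} (hr : r.IsChain Site.Next)
    (h0 : ∀ κ ∈ r.head?, Site.LevelStart N κ) (M q : ℕ) (hM : q + M = N) :
    ((List.range' q M).map Site.cup ++ r).IsChain Site.Next ∧
      ∀ κ ∈ ((List.range' q M).map Site.cup ++ r).head?, κ = .cup q ∨ Site.LevelStart q κ := by
  induction M generalizing q with
  | zero =>
    simp only [add_zero] at hM
    subst hM
    exact ⟨hr, fun κ hκ => Or.inr (h0 κ hκ)⟩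
  | succ M ih =>
    have ih := ih (q + 1) (by omega)
    refine ⟨?_, by simp [List.range'_succ]⟩
    simp only [List.range'_succ, List.map_cons, List.cons_append]
    rw [List.isChain_cons]
    exact ⟨fun κ hκ => ih.2 κ hκ, ih.1⟩

theorem next_sites (G : ℕ → ℕ) (N : ℕ) :
    (sites G N).IsChain Site.Next ∧
      ∀ κ ∈ (sites G N).head?, κ = .cup 0 ∨ Site.LevelStart 0 κ := by
  rw [sites, List.range_eq_range']
  exact next_cups (next_levelSites G N).1 (next_levelSites G N).2 N 0 (by simp)

theorem special_notMem_twistSites (p g : ℕ) : Site.special ∉ twistSites p g := by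
  induction g with
  | zero => simp [twistSites]
  | succ g ih => simp [twistSites, ih]

theorem special_notMem_levelSites (G : ℕ → ℕ) (p : ℕ) : Site.special ∉ levelSites G p := by
  induction p with
  | zero => exact special_notMem_twistSites _ _
  | succ p ih => simp [levelSites, ih, special_notMem_twistSites]

/-- Inside the list the relation is the chain condition. The special crossing occurs only at the
end, and its cyclic successor is column zero, whose site is allowed to follow it. -/
theorem isClosed_sites (G : ℕ → ℕ) (N : ℕ) : IsClosed (sites G N) := by
  obtain ⟨hc, hh⟩ := next_sites G N
  obtain ⟨r, hr, hm⟩ : ∃ r, sites G N = r ++ [.special] ∧ Site.special ∉ r := by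
    refine ⟨(List.range N).map .cup ++ (levelSites G N ++ [.last]), by simp [sites], ?_⟩
    simp [special_notMem_levelSites]
  have hs : ∀ s, (sites G N)[s]? = some .special ↔ s + 1 = (sites G N).length := by
    intro s
    rw [hr]
    simp only [List.length_append, List.length_cons, List.length_nil]
    constructor
    · intro h
      by_contra hne
      rcases lt_or_ge s r.length with h1 | h1
      · rw [List.getElem?_append_left h1] at h
        exact hm (List.mem_of_getElem? h)
      · have h2 := (List.getElem?_eq_some_iff.mp h).1
        simp at h2
        omega
    · intro h
      have : s = r.length := by omega
      subst this
      simp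
  have hpos : 0 < (sites G N).length := by rw [hr]; simp
  refine ⟨?_, hs, hpos⟩
  intro s κ hκ
  have hlt := (List.getElem?_eq_some_iff.mp hκ).1
  have hg := (List.getElem?_eq_some_iff.mp hκ).2
  by_cases he : s + 1 = (sites G N).length
  · have := (hs s).2 he
    rw [hκ] at this
    obtain rfl : κ = .special := by simpa using this
    have h0 : nextCol (siteWord (sites G N)) s = 0 := by simp [nextCol, he]
    rw [h0]
    exact ⟨(sites G N)[0], by simp [hpos], hh _ (by simp [List.head?_eq_getElem?, hpos])⟩
  · have hlt' : s + 1 < (sites G N).length := by omega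
    have h0 : nextCol (siteWord (sites G N)) s = s + 1 := by
      simp [nextCol, Nat.mod_eq_of_lt hlt']
    rw [h0]
    refine ⟨(sites G N)[s + 1], by simp [hlt'], ?_⟩
    have := List.isChain_iff_getElem.mp hc s (by omega)
    rwa [hg] at this

/-! ### Normal form of the standard fronts -/

/-- The levels `p, …, 0` of a standard front, with `G i` full twists in level `i`. -/
def frontLevels (G : ℕ → ℕ) : ℕ → List FrontLetter
  | 0 => List.replicate (2 * G 0) (.crossing 0)
  | p + 1 => List.replicate (2 * G (p + 1)) (.crossing (2 * p + 2)) ++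
      .crossing (2 * p) :: .rightCusp (2 * p + 1) :: frontLevels G p

/-- The standard front with `N` vertical crossings and `G i` full twists in level `i`. -/
def frontStandard (G : ℕ → ℕ) (N : ℕ) : List FrontLetter :=
  (List.range N).map (fun q => .leftCusp (2 * q + 1)) ++ frontLevels G N

/-- The sequence of twists after adding a vertical crossing. -/
def delay (G : ℕ → ℕ) : ℕ → ℕ
  | 0 => 0
  | p + 1 => G p

/-- The crossings of level `p` have height `2 * p`. Moving the old tangle up by two strands raises
every level by one, and an empty level zero appears on the right. -/
theorem frontLevels_delay (G : ℕ → ℕ) (p : ℕ) :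
    frontLevels (delay G) (p + 1) =
      (frontLevels G p).map (FrontLetter.shift 2) ++ [.crossing 0, .rightCusp 1] := by
  induction p with
  | zero => simp [frontLevels, delay, FrontLetter.shift]
  | succ p ih =>
    rw [frontLevels, ih]
    simp [frontLevels, delay, FrontLetter.shift, mul_add]

theorem verticalAdd_frontStandard (G : ℕ → ℕ) (N : ℕ) :
    verticalAdd (frontStandard G N) = frontStandard (delay G) (N + 1) := by
  rw [frontStandard, frontStandard, frontLevels_delay, List.range_succ_eq_map]
  simp [verticalAdd, FrontLetter.shift, Function.comp_def, mul_add]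

theorem horizontalAdd_frontLevels (G : ℕ → ℕ) (m p : ℕ) :
    horizontalAdd (2 * m) (frontLevels G p) = frontLevels (Function.update G 0 (G 0 + m)) p := by
  induction p with
  | zero => simp [horizontalAdd, frontLevels, mul_add]
  | succ p ih =>
    rw [frontLevels, frontLevels, ← ih]
    simp [horizontalAdd]

theorem horizontalAdd_frontStandard (G : ℕ → ℕ) (m N : ℕ) :
    horizontalAdd (2 * m) (frontStandard G N) =
      frontStandard (Function.update G 0 (G 0 + m)) N := by
  rw [frontStandard, frontStandard, ← horizontalAdd_frontLevels]
  simp [horizontalAdd]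

theorem resolve_twists (p g : ℕ) :
    (List.replicate (2 * g) (FrontLetter.crossing (2 * p))).flatMap FrontLetter.resolve =
      (twistSites p g).map Site.letter := by
  induction g with
  | zero => simp [twistSites]
  | succ g ih =>
    rw [mul_add, mul_one, List.replicate_succ, List.replicate_succ]
    simp [twistSites, FrontLetter.resolve, ih, Site.letter]

theorem resolve_frontLevels (G : ℕ → ℕ) (p : ℕ) :
    (frontLevels G p).flatMap FrontLetter.resolve = (levelSites G p).map Site.letter := by
  induction p with
  | zero => exact resolve_twists 0 (G 0)
  | succ p ih =>
    have := resolve_twists (p + 1) (G (p + 1))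
    rw [mul_add, mul_one] at this
    simp [frontLevels, levelSites, ih, this, FrontLetter.resolve, Site.letter]

theorem resolution_frontStandard (G : ℕ → ℕ) (N : ℕ) :
    resolution (frontStandard G N) = siteWord (sites G N) := by
  have h : ((List.range N).map fun q => FrontLetter.leftCusp (2 * q + 1)).flatMap
      FrontLetter.resolve = ((List.range N).map Site.cup).map Site.letter := by
    induction List.range N with
    | nil => rfl
    | cons a l ih => simp [ih, FrontLetter.resolve, Site.letter]
  rw [resolution, frontStandard, List.flatMap_append, h, resolve_frontLevels]
  simp [sites, Site.letter, transition, List.range_succ]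

open LaurentPolynomial in
/-- `∑ G_p λ^p`. -/
noncomputable def twistPoly (G : ℕ → ℕ) (N : ℕ) : LaurentPolynomial ℤ :=
  ∑ p ∈ Finset.range (N + 1), C (G p : ℤ) * T (p : ℤ)

open LaurentPolynomial in
theorem twistPoly_delay (G : ℕ → ℕ) (N : ℕ) :
    twistPoly (delay G) (N + 1) = T 1 * twistPoly G N := by
  rw [twistPoly, Finset.sum_range_succ', twistPoly, Finset.mul_sum]
  simp only [delay, Nat.cast_zero, map_zero, zero_mul, add_zero]
  refine Finset.sum_congr rfl fun p _ => ?_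
  rw [mul_left_comm, ← T_add, Nat.cast_succ, add_comm]

open LaurentPolynomial in
theorem twistPoly_update (G : ℕ → ℕ) (m N : ℕ) :
    twistPoly (Function.update G 0 (G 0 + m)) N = C (m : ℤ) + twistPoly G N := by
  rw [twistPoly, Finset.sum_range_succ', twistPoly, Finset.sum_range_succ']
  simp
  ring

-- Each vertical addition shifts all levels, which multiplies the polynomial by `λ`. After at least
-- one of them level zero is empty, ready to receive the next horizontal twists.
open LaurentPolynomial in
theorem verticalAdd_iterate_frontStandard (G : ℕ → ℕ) (N m : ℕ) :
    ∃ G', verticalAdd^[m] (frontStandard G N) = frontStandard G' (N + m) ∧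
      twistPoly G' (N + m) = T (m : ℤ) * twistPoly G N ∧ (1 ≤ m → G' 0 = 0) := by
  induction m with
  | zero => exact ⟨G, by simp⟩
  | succ m ih =>
    obtain ⟨G', h1, h2, -⟩ := ih
    refine ⟨delay G', ?_, ?_, fun _ => rfl⟩
    · rw [Function.iterate_succ_apply', h1, verticalAdd_frontStandard]; rfl
    · rw [← add_assoc, twistPoly_delay, h2, ← mul_assoc, ← T_add, Nat.cast_succ, add_comm]

-- Horizontal addition changes level zero only, so the exponent attached to `h l` is the number of
-- vertical additions made after it. Positivity of `v i` keeps the twists `h i` from merging with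
-- those of the inner tangle.
open LaurentPolynomial in
theorem standardTangle_eq_frontStandard (h v : ℕ → ℕ) (m i : ℕ)
    (hv : ∀ k, i ≤ k → k < i + m → 1 ≤ v k) :
    ∃ G N, standardTangle h v i m = frontStandard G N ∧ G 0 = h i ∧
      twistPoly G N = ∑ l ∈ Finset.Icc i (i + m),
        C (h l : ℤ) * T (∑ k ∈ Finset.Ico i l, (v k : ℤ)) := by
  induction m generalizing i with
  | zero => exact ⟨fun _ => h i, 0, by simp [standardTangle, frontStandard, frontLevels, horizontalAdd,
      twistPoly]⟩
  | succ m ih =>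
    obtain ⟨G, N, h1, -, h3⟩ := ih (i + 1) fun k hk hk' => hv k (by omega) (by omega)
    obtain ⟨G', h4, h5, h6⟩ := verticalAdd_iterate_frontStandard G N (v i)
    have h0 : G' 0 = 0 := h6 (hv i le_rfl (by omega))
    refine ⟨Function.update G' 0 (G' 0 + h i), N + v i, ?_, by simp [h0], ?_⟩
    · rw [standardTangle, h1, h4, horizontalAdd_frontStandard]
    · rw [twistPoly_update, h5, h3, Finset.mul_sum,
        ← Finset.insert_Icc_succ_left_eq_Icc (by omega : i ≤ i + (m + 1)),
        Finset.sum_insert (by simp)]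
      have e : Finset.Icc (Order.succ i) (i + (m + 1)) = Finset.Icc (i + 1) (i + 1 + m) := by
        rw [Nat.succ_eq_succ]; congr 1; omega
      rw [e]
      simp only [Finset.Ico_self, Finset.sum_empty, T_zero, mul_one]
      congr 1
      refine Finset.sum_congr rfl fun l hl => ?_
      rw [Finset.mem_Icc] at hl
      rw [mul_left_comm, ← T_add, Finset.sum_eq_sum_Ico_succ_bot (by omega : i < l)]

end LegendrianSolidTorus

namespace LegendrianSolidTorus

/-! ### Components and potentials -/

/-- The component and the potential of the strands of level `p`. -/
def levelLabel (p i : ℕ) : Option (Fin 2 × ℤ) :=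
  if i = 2 * p + 1 then some (1, 0) else if i < 2 * p + 1 then some (0, -((i / 2 : ℕ) : ℤ)) else none

namespace Site

/-- The component and the potential of the strands on the left of a site. -/
def label : Site → ℕ → Option (Fin 2 × ℤ)
  | cup q, i => levelLabel q i
  | odd p, i => levelLabel p i
  | even p, i => levelLabel p (swapAt (2 * p) i)
  | vert p, i => levelLabel (p + 1) i
  | loop p, i => levelLabel (p + 1) (swapAt (2 * p) i)
  | cap p, i => levelLabel (p + 1) (swapAt (2 * p) (swapAt (2 * p + 1) i))
  | last, i => levelLabel 0 i
  | special, i => levelLabel 0 (swapAt 0 i)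

theorem LevelStart.label_eq {p : ℕ} {κ : Site} (h : LevelStart p κ) : κ.label = levelLabel p := by
  rcases h with rfl | ⟨r, rfl, rfl⟩ | ⟨rfl, rfl⟩ <;> rfl

theorem swapAt_swapAt (k i : ℕ) : swapAt k (swapAt k i) = i := by
  unfold swapAt; split_ifs <;> omega

/-- Labels are read at the start of a level and transported through its crossings, so at a crossing
only the involutivity of a transposition is used. The two arcs need arithmetic. -/
theorem Next.label_eq {κ κ' : Site} (h : κ.Next κ') {i i' : ℕ} (ht : Through κ.letter i i') :
    κ.label i = κ'.label i' := by
  cases κ with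
  | cup q =>
    have hl : κ'.label = levelLabel (q + 1) := by
      rcases h with rfl | h
      · rfl
      · exact h.label_eq
    have ht : i' = liftAt (2 * q + 1) i := ht
    rw [hl, ht]
    simp only [label, levelLabel, liftAt]
    split_ifs <;> first | rfl | omega
  -- The strand left in position `2 * p` was number `2 * p + 1` at the start of the level; division
  -- by two with rounding gives both numbers the same potential.
  | cap p =>
    have ht : i = liftAt (2 * p + 1) i' := ht
    rw [LevelStart.label_eq h, ht]
    simp only [label, levelLabel, liftAt, swapAt]
    split_ifs <;> first | rfl | omega | (congr 4; omega)
  | odd p =>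
    obtain rfl : κ' = even p := h
    obtain rfl : i' = swapAt (2 * p) i := ht
    simp [label, swapAt_swapAt]
  | even p =>
    obtain rfl : i' = swapAt (2 * p) i := ht
    rw [LevelStart.label_eq h]; rfl
  | vert p =>
    obtain rfl : κ' = loop p := h
    obtain rfl : i' = swapAt (2 * p) i := ht
    simp [label, swapAt_swapAt]
  | loop p =>
    obtain rfl : κ' = cap p := h
    obtain rfl : i' = swapAt (2 * p + 1) i := ht
    simp [label, swapAt_swapAt]
  | last =>
    obtain rfl : κ' = special := h
    obtain rfl : i' = swapAt 0 i := ht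
    simp [label, swapAt_swapAt]
  | special =>
    obtain rfl : i' = swapAt 0 i := ht
    have hl : κ'.label = levelLabel 0 := by
      rcases h with rfl | h
      · rfl
      · exact h.label_eq
    rw [hl]; rfl

theorem letter_eq_cup {κ : Site} {k : ℕ} (h : κ.letter = .cup k) :
    ∃ q, κ = cup q ∧ k = 2 * q + 1 := by
  cases κ <;> simp_all [letter]

theorem letter_eq_cap {κ : Site} {k : ℕ} (h : κ.letter = .cap k) :
    ∃ q, κ = cap q ∧ k = 2 * q + 1 := by
  cases κ <;> simp_all [letter]

theorem Next.cup_label {q : ℕ} {κ : Site} (h : (cup q).Next κ) :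
    κ.label (2 * q + 1) = some (0, -(q : ℤ)) ∧
      κ.label (2 * q + 1 + 1) = some (0, -((q + 1 : ℕ) : ℤ)) := by
  have hl : κ.label = levelLabel (q + 1) := by
    rcases h with rfl | h
    · rfl
    · exact h.label_eq
  rw [hl]
  constructor
  · simp only [levelLabel]; rw [if_neg (by omega), if_pos (by omega)]; congr 4; omega
  · simp only [levelLabel]; rw [if_neg (by omega), if_pos (by omega)]; congr 4; omega

theorem cap_label (p : ℕ) :
    (cap p).label (2 * p + 1) = some (0, -((p + 1 : ℕ) : ℤ)) ∧
      (cap p).label (2 * p + 1 + 1) = some (0, -(p : ℤ)) := by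
  have e1 : swapAt (2 * p) (swapAt (2 * p + 1) (2 * p + 1)) = 2 * p + 2 := by
    unfold swapAt; split_ifs <;> omega
  have e2 : swapAt (2 * p) (swapAt (2 * p + 1) (2 * p + 1 + 1)) = 2 * p := by
    unfold swapAt; split_ifs <;> omega
  simp only [label, e1, e2, levelLabel]
  constructor
  · rw [if_neg (by omega), if_pos (by omega)]; congr 4; omega
  · rw [if_neg (by omega), if_pos (by omega)]; congr 4; omega

end Site

theorem getElem?_siteWord {K : List Site} {s : ℕ} {ℓ : Letter} :
    (siteWord K)[s]? = some ℓ ↔ ∃ κ, K[s]? = some κ ∧ κ.letter = ℓ := by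
  simp [List.getElem?_map]

/-- The component and the potential of a point of a diagram. -/
def labelAt (K : List Site) (x : ℕ × ℕ) : Option (Fin 2 × ℤ) :=
  K[x.1]?.bind fun κ => κ.label x.2

theorem labelAt_of_getElem? {K : List Site} {s : ℕ} {κ : Site} (h : K[s]? = some κ) (i : ℕ) :
    labelAt K (s, i) = κ.label i := by
  simp [labelAt, h]

namespace IsClosed

variable {K : List Site} (hK : IsClosed K)
include hK

theorem labelAt_through {s i i' : ℕ} {ℓ : Letter} (hs : (siteWord K)[s]? = some ℓ)
    (hi : Through ℓ i i') : labelAt K (s, i) = labelAt K (nextCol (siteWord K) s, i') := by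
  obtain ⟨κ, h, rfl⟩ := getElem?_siteWord.mp hs
  obtain ⟨κ', h', hn⟩ := hK.next s κ h
  rw [labelAt_of_getElem? h, labelAt_of_getElem? h', hn.label_eq hi]

theorem labelAt_cup {s k : ℕ} (hs : (siteWord K)[s]? = some (.cup k)) :
    ∃ m : ℤ, labelAt K (nextCol (siteWord K) s, k) = some (0, m + 1) ∧
      labelAt K (nextCol (siteWord K) s, k + 1) = some (0, m) := by
  obtain ⟨κ, h, hl⟩ := getElem?_siteWord.mp hs
  obtain ⟨q, rfl, rfl⟩ := Site.letter_eq_cup hl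
  obtain ⟨κ', h', hn⟩ := hK.next s _ h
  obtain ⟨h1, h2⟩ := hn.cup_label
  refine ⟨_, ?_, (labelAt_of_getElem? h' _).trans h2⟩
  rw [labelAt_of_getElem? h', h1]
  congr 2; push_cast; ring

omit hK in
theorem labelAt_cap {s k : ℕ} (hs : (siteWord K)[s]? = some (.cap k)) :
    ∃ m : ℤ, labelAt K (s, k + 1) = some (0, m + 1) ∧ labelAt K (s, k) = some (0, m) := by
  obtain ⟨κ, h, hl⟩ := getElem?_siteWord.mp hs
  obtain ⟨q, rfl, rfl⟩ := Site.letter_eq_cap hl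
  obtain ⟨h1, h2⟩ := Site.cap_label q
  refine ⟨_, ?_, (labelAt_of_getElem? h _).trans h1⟩
  rw [labelAt_of_getElem? h, h2]
  congr 2; push_cast; ring

/-- The second entry of a label is a potential for the cusp count: it is constant along strands and
jumps at an arc by the amount the path records. A path to a base point thus has no freedom in its
component or its count. -/
theorem labelAt_eq_of_cuspPath {x y : ℕ × ℕ} {m : ℤ} (γ : CuspPath (siteWord K) x y m) :
    labelAt K x = (labelAt K y).map fun l => (l.1, l.2 + m) := by
  induction γ with
  | refl x => simp
  | goRight ℓ hs hi _ ih => rw [hK.labelAt_through hs hi, ih]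
  | goLeft ℓ hs hi _ ih => rw [← hK.labelAt_through hs hi, ih]
  | cupUp hs _ ih =>
    obtain ⟨n, h1, h2⟩ := hK.labelAt_cup hs
    rw [h2] at ih; rw [h1]
    obtain ⟨l, h, hl⟩ := Option.map_eq_some_iff.mp ih.symm
    simp only [Prod.mk.injEq] at hl
    simp [h, ← hl.1, ← hl.2, add_assoc]
  | cupDown hs _ ih =>
    obtain ⟨n, h1, h2⟩ := hK.labelAt_cup hs
    rw [h1] at ih; rw [h2]
    obtain ⟨l, h, hl⟩ := Option.map_eq_some_iff.mp ih.symm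
    simp only [Prod.mk.injEq] at hl
    simp only [h, Option.map_some, hl.1]
    congr 2; linarith [hl.2]
  | capUp hs _ ih =>
    obtain ⟨n, h1, h2⟩ := labelAt_cap hs
    rw [h2] at ih; rw [h1]
    obtain ⟨l, h, hl⟩ := Option.map_eq_some_iff.mp ih.symm
    simp only [Prod.mk.injEq] at hl
    simp [h, ← hl.1, ← hl.2, add_assoc]
  | capDown hs _ ih =>
    obtain ⟨n, h1, h2⟩ := labelAt_cap hs
    rw [h1] at ih; rw [h2]
    obtain ⟨l, h, hl⟩ := Option.map_eq_some_iff.mp ih.symm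
    simp only [Prod.mk.injEq] at hl
    simp only [h, Option.map_some, hl.1]
    congr 2; linarith [hl.2]

omit hK in
theorem nextCol_eq {s : ℕ} (h : s + 1 < K.length) : nextCol (siteWord K) s = s + 1 := by
  simp [nextCol, Nat.mod_eq_of_lt h]

theorem getElem?_zero : ∃ κ, K[0]? = some κ ∧ (κ = .cup 0 ∨ Site.LevelStart 0 κ) := by
  have h1 : K.length - 1 + 1 = K.length := Nat.sub_add_cancel hK.pos
  obtain ⟨κ, h, hn⟩ := hK.next _ _ ((hK.special_iff (K.length - 1)).2 h1)
  refine ⟨κ, ?_, hn⟩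
  rwa [nextCol, List.length_map, h1, Nat.mod_self] at h

theorem labelAt_zero (i : ℕ) : labelAt K (0, i) = levelLabel 0 i := by
  obtain ⟨κ, h, hκ⟩ := hK.getElem?_zero
  rw [labelAt_of_getElem? h]
  rcases hκ with rfl | hκ
  · rfl
  · rw [hκ.label_eq]

theorem labelAt_basePoint (j : Fin 2) : labelAt K (basePoint j) = some (j, 0) := by
  rw [basePoint, hK.labelAt_zero]
  fin_cases j <;> simp [levelLabel]

end IsClosed

/-! ### Capping paths to the base points. -/

namespace CuspPath

variable {W : List Letter}

theorem trans {x y z : ℕ × ℕ} {m n : ℤ} (γ : CuspPath W x y m) (δ : CuspPath W y z n) :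
    CuspPath W x z (m + n) := by
  induction γ with
  | refl x => simpa using δ
  | goRight ℓ hs hi _ ih => exact goRight ℓ hs hi (ih δ)
  | goLeft ℓ hs hi _ ih => exact goLeft ℓ hs hi (ih δ)
  | cupUp hs _ ih => rw [add_right_comm]; exact cupUp hs (ih δ)
  | cupDown hs _ ih => rw [sub_add_eq_add_sub]; exact cupDown hs (ih δ)
  | capUp hs _ ih => rw [add_right_comm]; exact capUp hs (ih δ)
  | capDown hs _ ih => rw [sub_add_eq_add_sub]; exact capDown hs (ih δ)

theorem symm {x y : ℕ × ℕ} {m : ℤ} (γ : CuspPath W x y m) : CuspPath W y x (-m) := by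
  induction γ with
  | refl x => simpa using refl x
  | goRight ℓ hs hi _ ih => simpa using ih.trans (goLeft ℓ hs hi (refl _))
  | goLeft ℓ hs hi _ ih => simpa using ih.trans (goRight ℓ hs hi (refl _))
  | cupUp hs _ ih => simpa [sub_eq_add_neg, add_comm] using ih.trans (cupDown hs (refl _))
  | cupDown hs _ ih => simpa [sub_eq_add_neg, add_comm] using ih.trans (cupUp hs (refl _))
  | capUp hs _ ih => simpa [sub_eq_add_neg, add_comm] using ih.trans (capDown hs (refl _))
  | capDown hs _ ih => simpa [sub_eq_add_neg, add_comm] using ih.trans (capUp hs (refl _))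

theorem of_eq {x y : ℕ × ℕ} {m n : ℤ} (γ : CuspPath W x y m) (h : m = n) : CuspPath W x y n :=
  h ▸ γ

/-- A path between two points of a column, moved to the next column. -/
theorem move {s i i' j j' : ℕ} {m : ℤ} {ℓ : Letter} (hs : W[s]? = some ℓ) (hi : Through ℓ i i')
    (hj : Through ℓ j j') (γ : CuspPath W (s, i) (s, j) m) :
    CuspPath W (nextCol W s, i') (nextCol W s, j') m :=
  (goLeft ℓ hs hi γ).trans (goRight ℓ hs hj (refl _)) |>.of_eq (add_zero m)

end CuspPath

namespace Site

/-- The level of a site. -/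
def level : Site → ℕ
  | cup q => q
  | odd p => p
  | even p => p
  | vert p => p + 1
  | loop p => p + 1
  | cap p => p + 1
  | last => 0
  | special => 0

/-- The position, on the left of a site, of the strand that was the `i`-th one at the beginning of
the level. -/
def position : Site → ℕ → ℕ
  | even p, i => swapAt (2 * p) i
  | loop p, i => swapAt (2 * p) i
  | cap p, i => swapAt (2 * p + 1) (swapAt (2 * p) i)
  | special, i => swapAt 0 i
  | _, i => i

end Site

/-- The connections between the strands in column `s` through the part of the diagram on its left. -/
structure LeftLinked (K : List Site) (s : ℕ) (p : ℕ) (f : ℕ → ℕ) : Prop where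
  pair : ∀ q < p, CuspPath (siteWord K) (s, f (2 * q + 1)) (s, f (2 * q + 2)) 1
  bottom : CuspPath (siteWord K) (s, f 0) (basePoint 0) 0
  top : CuspPath (siteWord K) (s, f (2 * p + 1)) (basePoint 1) 0

namespace LeftLinked

variable {K : List Site} {s p : ℕ} {f : ℕ → ℕ}

theorem cross (h : LeftLinked K s p f) {k : ℕ} {ty : CrossingType}
    (hs : (siteWord K)[s]? = some (.cross k ty)) :
    LeftLinked K (nextCol (siteWord K) s) p (fun i => swapAt k (f i)) where
  pair q hq := (h.pair q hq).move hs rfl rfl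
  bottom := .goLeft _ hs rfl h.bottom
  top := .goLeft _ hs rfl h.top

theorem congr (h : LeftLinked K s p f) {g : ℕ → ℕ} (hg : ∀ i, f i = g i) :
    LeftLinked K s p g := by
  obtain rfl : f = g := funext hg
  exact h

theorem cup (h : LeftLinked K s p id) (hs : (siteWord K)[s]? = some (.cup (2 * p + 1))) :
    LeftLinked K (nextCol (siteWord K) s) (p + 1) id where
  pair q hq := by
    rcases Nat.lt_succ_iff_lt_or_eq.mp hq with hq | rfl
    · refine (h.pair q hq).move hs ?_ ?_ <;> simp only [Through, liftAt, id] <;> split_ifs <;> omega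
    · exact .cupUp hs (.refl _)
  bottom := .goLeft _ hs (by simp [Through, liftAt]) h.bottom
  top := .goLeft _ hs (by simp only [Through, liftAt, id]; split_ifs <;> omega) h.top

theorem cap (h : LeftLinked K s (p + 1) (Site.cap p).position)
    (hs : (siteWord K)[s]? = some (.cap (2 * p + 1))) :
    LeftLinked K (nextCol (siteWord K) s) p id := by
  have hpos : ∀ i, i < 2 * p → (Site.cap p).position i = i := by
    intro i hi; simp only [Site.position, swapAt]; split_ifs <;> omega
  have h0 : (Site.cap p).position (2 * p) = 2 * p + 2 := by
    simp only [Site.position, swapAt]; split_ifs <;> omega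
  have h1 : (Site.cap p).position (2 * p + 1) = 2 * p := by
    simp only [Site.position, swapAt]; split_ifs <;> omega
  have h2 : (Site.cap p).position (2 * p + 2) = 2 * p + 1 := by
    simp only [Site.position, swapAt]; split_ifs <;> omega
  have h3 : (Site.cap p).position (2 * (p + 1) + 1) = 2 * p + 3 := by
    simp only [Site.position, swapAt]; split_ifs <;> omega
  -- The arc joins the upper strand to one that the part of the diagram on the left connects with
  -- position `2 * p`; the cusp counts `1` and `-1` cancel.
  have hA : CuspPath (siteWord K) (s, 2 * p + 2) (s, 2 * p) 0 := by
    have := h.pair p (by omega)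
    rw [h1, h2] at this
    exact (CuspPath.capUp hs this.symm).of_eq (by simp)
  refine ⟨fun q hq => ?_, ?_, ?_⟩
  · have hq' := h.pair q (by omega)
    rw [hpos _ (by omega)] at hq'
    by_cases hqp : q + 1 = p
    · have e : 2 * q + 2 = 2 * p := by omega
      rw [e, h0] at hq'
      refine (hq'.trans hA).move hs ?_ ?_ <;> simp only [Through, liftAt, id] <;> split_ifs <;> omega
    · rw [hpos _ (by omega)] at hq'
      refine hq'.move hs ?_ ?_ <;> simp only [Through, liftAt, id] <;> split_ifs <;> omega
  · refine .goLeft (i := 0) _ hs (by simp [Through, liftAt]) ?_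
    have hb := h.bottom
    rcases Nat.eq_zero_or_pos p with rfl | hp
    · rw [h0] at hb
      exact (hA.symm.trans hb).of_eq (by simp)
    · rwa [hpos 0 (by omega)] at hb
  · have ht := h.top
    rw [h3] at ht
    exact .goLeft _ hs (by simp [Through, liftAt]) ht

end LeftLinked

namespace IsClosed

variable {K : List Site} (hK : IsClosed K)
include hK

/-- Followed to the right, a strand may turn back at an arc `⊃`. The links accumulated from the left
say where it then comes out. -/
theorem leftLinked (s : ℕ) : ∀ κ, K[s]? = some κ → LeftLinked K s κ.level κ.position := by
  induction s with
  | zero =>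
    intro κ h
    obtain ⟨κ', h', hκ⟩ := hK.getElem?_zero
    obtain rfl : κ = κ' := by simpa [h] using h'
    have : LeftLinked K 0 0 id := ⟨by simp, .refl _, .refl _⟩
    rcases hκ with rfl | rfl | ⟨r, hr, rfl⟩ | ⟨-, rfl⟩
    · exact this
    · exact this
    · omega
    · exact this
  | succ s ih =>
    intro κ' h'
    have hlt := (List.getElem?_eq_some_iff.mp h').1
    have hs : K[s]? = some K[s] := by simp
    obtain ⟨κ'', h'', hn⟩ := hK.next s _ hs
    rw [nextCol_eq hlt, h'] at h''
    obtain rfl : κ' = κ'' := by simpa using h''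
    have ih := ih _ hs
    have hw : (siteWord K)[s]? = some K[s].letter := by simp [hs]
    have hstart : ∀ p, Site.LevelStart p κ' → LeftLinked K (s + 1) p id →
        LeftLinked K (s + 1) κ'.level κ'.position := by
      rintro p (rfl | ⟨r, rfl, rfl⟩ | ⟨rfl, rfl⟩) h <;> exact h
    rw [← nextCol_eq hlt] at hstart ⊢
    generalize K[s] = κ at *
    cases κ with
    | cup q =>
      have := LeftLinked.cup ih hw
      rcases hn with rfl | hn
      · exact this
      · exact hstart _ hn this
    | odd p => obtain rfl := hn; exact LeftLinked.cross ih hw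
    | even p =>
      exact hstart _ hn ((LeftLinked.cross ih hw).congr fun i => Site.swapAt_swapAt _ _)
    | vert p => obtain rfl := hn; exact LeftLinked.cross ih hw
    | loop p => obtain rfl := hn; exact LeftLinked.cross ih hw
    | cap p => exact hstart _ hn (LeftLinked.cap ih hw)
    | last => obtain rfl := hn; exact LeftLinked.cross ih hw
    | special =>
      have := (hK.special_iff s).1 hs
      omega

/-- Every strand is connected to its base point. -/
theorem cuspPath_basePoint (s : ℕ) (hs : s < K.length) :
    ∀ i j m, labelAt K (s, i) = some (j, m) → CuspPath (siteWord K) (s, i) (basePoint j) m := by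
  -- Induction on the distance to the end of the list, since strands are followed to the right.
  obtain ⟨d, hd⟩ : ∃ d, s + 1 + d = K.length := ⟨K.length - (s + 1), by omega⟩
  induction d generalizing s with
  | zero =>
    have hsp := (hK.special_iff s).2 hd
    have hw : (siteWord K)[s]? = some (.cross 0 .special) := by simp [hsp, Site.letter]
    have h0 : nextCol (siteWord K) s = 0 := by
      rw [nextCol, List.length_map, show s + 1 = K.length by omega, Nat.mod_self]
    intro i j m h
    rw [hK.labelAt_through hw rfl, h0, hK.labelAt_zero] at h
    refine .goRight _ hw rfl ?_
    rw [h0]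
    simp only [levelLabel] at h
    split_ifs at h with h1 h2
    · simp only [Option.some.injEq, Prod.mk.injEq] at h
      rw [h1, ← h.1, ← h.2]
      exact .refl _
    · have h3 : swapAt 0 i = 0 := by omega
      simp only [Option.some.injEq, Prod.mk.injEq, h3] at h
      rw [h3, ← h.1, ← h.2]
      exact .refl _
  | succ d ih =>
    have ih := ih (s + 1) (by omega) (by omega)
    have hκ : K[s]? = some K[s] := by simp
    have hw : (siteWord K)[s]? = some K[s].letter := getElem?_siteWord.mpr ⟨_, hκ, rfl⟩
    have ht : ∀ i i' j m, Through K[s].letter i i' → labelAt K (s, i) = some (j, m) →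
        CuspPath (siteWord K) (s, i) (basePoint j) m := by
      intro i i' j m hi h
      rw [hK.labelAt_through hw hi, nextCol_eq (by omega)] at h
      have := ih _ _ _ h
      rw [← nextCol_eq (K := K) (by omega)] at this
      exact .goRight _ hw hi this
    have hl := hK.leftLinked s _ hκ
    intro i j m h
    generalize K[s] = κ at *
    cases κ with
    | cap p =>
      have hbelow : ∀ i j m, i < 2 * p + 1 → labelAt K (s, i) = some (j, m) →
          CuspPath (siteWord K) (s, i) (basePoint j) m := fun i j m hi h =>
        ht i i j m (by simp [Site.letter, Through, liftAt, hi]) h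
      -- The upper strand at the arc started the level as number `2 * p`. To the left it leads to
      -- the base point if `p = 0`, and otherwise to strand `2 * p - 1`, which passes below the arc
      -- and is covered by the induction.
      have hupper : CuspPath (siteWord K) (s, 2 * p + 2) (basePoint 0) (-(p : ℤ)) := by
        have h0 : (Site.cap p).position (2 * p) = 2 * p + 2 := by
          simp only [Site.position, swapAt]; split_ifs <;> omega
        rcases p with _ | q
        · simpa [h0] using hl.bottom
        · have h1 : (Site.cap (q + 1)).position (2 * q + 1) = 2 * q + 1 := by
            simp only [Site.position, swapAt]; split_ifs <;> omega
          have hq : labelAt K (s, 2 * q + 1) = some (0, -(q : ℤ)) := by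
            rw [labelAt_of_getElem? hκ]
            have : swapAt (2 * (q + 1)) (swapAt (2 * (q + 1) + 1) (2 * q + 1)) = 2 * q + 1 := by
              simp only [swapAt]; split_ifs <;> omega
            simp only [Site.label, levelLabel, this]
            rw [if_neg (by omega), if_pos (by omega)]; congr 4; omega
          have := hl.pair q (by simp [Site.level])
          rw [h1, show 2 * q + 2 = 2 * (q + 1) by ring, h0] at this
          refine (this.symm.trans (hbelow _ _ _ (by omega) hq)).of_eq ?_
          push_cast; ring
      rcases lt_trichotomy i (2 * p + 1) with hi | rfl | hi
      · exact hbelow i j m hi h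
      · rw [labelAt_of_getElem? hκ, (Site.cap_label p).1] at h
        simp only [Option.some.injEq, Prod.mk.injEq] at h
        rw [← h.1, ← h.2]
        refine (CuspPath.capDown hw hupper).of_eq ?_
        push_cast; ring
      · rcases Nat.eq_or_lt_of_le hi with rfl | hi
        · rw [labelAt_of_getElem? hκ, (Site.cap_label p).2] at h
          simp only [Option.some.injEq, Prod.mk.injEq] at h
          rw [← h.1, ← h.2]
          exact hupper
        · refine ht i (i - 2) j m ?_ h
          simp only [Site.letter, Through, liftAt]
          rw [if_neg (by omega)]; omega
    | _ => exact ht i _ j m rfl h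

theorem cuspPath_basePoint_iff {x : ℕ × ℕ} {j : Fin 2} {m : ℤ} (hx : x.1 < K.length) :
    CuspPath (siteWord K) x (basePoint j) m ↔ labelAt K x = some (j, m) := by
  refine ⟨fun h => ?_, hK.cuspPath_basePoint x.1 hx x.2 j m⟩
  rw [hK.labelAt_eq_of_cuspPath h, hK.labelAt_basePoint]
  simp

end IsClosed

/-! ### The vertices -/

/-- The site of a vertex. -/
def siteOf {K : List Site} (a : Vertex (siteWord K)) : Site :=
  K[(a.1 : ℕ)]'(by simpa using a.1.2)

theorem getElem?_vertex {K : List Site} (a : Vertex (siteWord K)) :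
    K[(a.1 : ℕ)]? = some (siteOf a) := by
  simp [siteOf]

theorem get_vertex {K : List Site} (a : Vertex (siteWord K)) :
    (siteWord K).get a.1 = (siteOf a).letter := by
  simp [siteOf]

theorem isCross_siteOf {K : List Site} (a : Vertex (siteWord K)) :
    (siteOf a).letter.isCross = true := by
  rw [← get_vertex]; exact a.2

namespace Site

/-- The component of the overstrand of a crossing. -/
def overComp : Site → Fin 2
  | odd _ => 1
  | last => 1
  | special => 1
  | _ => 0

/-- The component of the understrand of a crossing. -/
def underComp : Site → Fin 2
  | even _ => 1
  | _ => 0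

/-- The degree of a crossing. -/
def deg : Site → ℤ
  | odd p => -(p : ℤ)
  | even p => p
  | loop _ => 1
  | special => -1
  | _ => 0

/-- The potential of the overstrand of a crossing. -/
def overPotential : Site → ℤ
  | even p => -(p : ℤ)
  | vert p => -(p : ℤ)
  | loop p => -((p + 1 : ℕ) : ℤ)
  | _ => 0

/-- The potential of the understrand of a crossing. -/
def underPotential : Site → ℤ
  | odd p => -(p : ℤ)
  | vert p => -(p : ℤ)
  | loop p => -(p : ℤ)
  | _ => 0

end Site

theorem labelAt_overPoint {K : List Site} (a : Vertex (siteWord K)) :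
    labelAt K (overPoint a) = some ((siteOf a).overComp, (siteOf a).overPotential) := by
  have h1 := getElem?_vertex a
  have h3 := isCross_siteOf a
  unfold overPoint
  rw [get_vertex]
  generalize siteOf a = κ at *
  cases κ <;> first
    | exact absurd h3 Bool.false_ne_true
    | refine (labelAt_of_getElem? h1 _).trans ?_
      simp only [Site.label, Site.overComp, Site.overPotential, levelLabel, swapAt]
      split_ifs <;> first | rfl | omega | (congr 2; omega)

theorem labelAt_underPoint {K : List Site} (a : Vertex (siteWord K)) :
    labelAt K (underPoint a) = some ((siteOf a).underComp, (siteOf a).underPotential) := by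
  have h1 := getElem?_vertex a
  have h3 := isCross_siteOf a
  unfold underPoint
  rw [get_vertex]
  generalize siteOf a = κ at *
  cases κ <;> first
    | exact absurd h3 Bool.false_ne_true
    | refine (labelAt_of_getElem? h1 _).trans ?_
      simp only [Site.label, Site.underComp, Site.underPotential, levelLabel, swapAt]
      split_ifs <;> first | contradiction | rfl | omega | (congr 2; omega)

theorem specialShift_eq {K : List Site} (a : Vertex (siteWord K)) :
    (siteOf a).underPotential - (siteOf a).overPotential - specialShift a = (siteOf a).deg := by
  have h3 := isCross_siteOf a
  unfold specialShift
  rw [get_vertex]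
  generalize siteOf a = κ at *
  cases κ <;> simp_all [Site.letter, Site.underPotential, Site.overPotential, Site.deg,
    Letter.isCross]

theorem overPoint_fst {W : List Letter} (a : Vertex W) : (overPoint a).1 = a.1 := by
  unfold overPoint; split <;> rfl

theorem underPoint_fst {W : List Letter} (a : Vertex W) : (underPoint a).1 = a.1 := by
  unfold underPoint; split <;> rfl

namespace IsClosed

variable {K : List Site} (hK : IsClosed K)
include hK

theorem cuspPath_overPoint_iff (a : Vertex (siteWord K)) (j : Fin 2) (m : ℤ) :
    CuspPath (siteWord K) (overPoint a) (basePoint j) m ↔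
      (siteOf a).overComp = j ∧ (siteOf a).overPotential = m := by
  rw [hK.cuspPath_basePoint_iff (by simpa [overPoint_fst] using a.1.2), labelAt_overPoint]
  simp

theorem cuspPath_underPoint_iff (a : Vertex (siteWord K)) (j : Fin 2) (m : ℤ) :
    CuspPath (siteWord K) (underPoint a) (basePoint j) m ↔
      (siteOf a).underComp = j ∧ (siteOf a).underPotential = m := by
  rw [hK.cuspPath_basePoint_iff (by simpa [underPoint_fst] using a.1.2), labelAt_underPoint]
  simp

theorem inSplit_iff (a : Vertex (siteWord K)) (j₁ j₂ : Fin 2) :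
    InSplit j₁ j₂ a ↔ (siteOf a).overComp = j₁ ∧ (siteOf a).underComp = j₂ := by
  simp [InSplit, OnComponent, hK.cuspPath_overPoint_iff, hK.cuspPath_underPoint_iff]

/-- Both capping counts are forced by the potential, so the choice made in `degree` is harmless. -/
theorem hasDegree_iff (a : Vertex (siteWord K)) (d : ℤ) : HasDegree a d ↔ d = (siteOf a).deg := by
  rw [← specialShift_eq]
  simp [HasDegree, hK.cuspPath_overPoint_iff, hK.cuspPath_underPoint_iff]

theorem degree_eq (a : Vertex (siteWord K)) : degree a = (siteOf a).deg :=
  (hK.hasDegree_iff a _).1 (Classical.epsilon_spec ⟨_, (hK.hasDegree_iff a _).2 rfl⟩)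

end IsClosed

end LegendrianSolidTorus

namespace LegendrianSolidTorus

/-! ### Right half disks -/

namespace IsClosed

variable {K : List Site} (hK : IsClosed K)
include hK

theorem getElem?_of_next_cap {s p : ℕ} {ℓ : Letter} (hs : (siteWord K)[s]? = some ℓ)
    (h : K[nextCol (siteWord K) s]? = some (.cap p)) : ℓ = .cross (2 * p + 1) .normal := by
  obtain ⟨κ, hκ, rfl⟩ := getElem?_siteWord.mp hs
  obtain ⟨κ', h', hn⟩ := hK.next s κ hκ
  obtain rfl : Site.cap p = κ' := by simpa [h] using h'
  cases κ <;> simp_all [Site.Next, Site.LevelStart, Site.letter]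

theorem getElem?_of_next_special {s : ℕ} {ℓ : Letter} (hs : (siteWord K)[s]? = some ℓ)
    (h : K[nextCol (siteWord K) s]? = some .special) : ℓ = .cross 0 .normal := by
  obtain ⟨κ, hκ, rfl⟩ := getElem?_siteWord.mp hs
  obtain ⟨κ', h', hn⟩ := hK.next s κ hκ
  obtain rfl : Site.special = κ' := by simpa [h] using h'
  cases κ <;> simp_all [Site.Next, Site.LevelStart, Site.letter]

/-- The only right half disks are the end pieces at caps and at the special crossing. -/
theorem right_halfDisk {σ : Side} {c i j : ℕ} (d : HalfDisk (siteWord K) σ c i j)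
    (hσ : σ = .right) :
    (∃ p, K[c]? = some (.cap p) ∧ i = 2 * p + 1 ∧ j = 2 * p + 2) ∨
      (K[c]? = some .special ∧ i = 0 ∧ j = 1) := by
  -- An extension to the left has to cross the preceding letter, which is always a normal crossing
  -- of precisely the two bounding strands.
  have key : ∀ {s i' j' : ℕ} {ℓ : Letter}, (siteWord K)[s]? = some ℓ →
      ((∃ p, K[nextCol (siteWord K) s]? = some (.cap p) ∧ i' = 2 * p + 1 ∧ j' = 2 * p + 2) ∨
        (K[nextCol (siteWord K) s]? = some .special ∧ i' = 0 ∧ j' = 1)) →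
      ℓ = .cross i' .normal ∧ j' = i' + 1 := by
    rintro s i' j' ℓ hs (⟨p, h, rfl, rfl⟩ | ⟨h, rfl, rfl⟩)
    · exact ⟨hK.getElem?_of_next_cap hs h, rfl⟩
    · exact ⟨hK.getElem?_of_next_special hs h, rfl⟩
  induction d with
  | stripR ℓ hs hi hj hij hij' d ih =>
    obtain ⟨rfl, rfl⟩ := key hs (ih rfl)
    -- A strip would reverse the order of its two sides here.
    simp only [Through, swapAt] at hi hj
    split_ifs at hi hj <;> omega
  | lowerCornerR hs hj d ih =>
    have := (key hs (ih rfl)).1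
    simp at this
  | upperCornerR hs hi d ih =>
    obtain ⟨h, -⟩ := key hs (ih rfl)
    simp only [Letter.cross.injEq] at h
    omega
  | endCornerR hs =>
    obtain ⟨κ, hκ, hl⟩ := getElem?_siteWord.mp hs
    right
    cases κ <;> simp_all [Site.letter]
  | endCap hs =>
    obtain ⟨κ, hκ, hl⟩ := getElem?_siteWord.mp hs
    obtain ⟨q, rfl, rfl⟩ := Site.letter_eq_cap hl
    exact .inl ⟨q, hκ, rfl, rfl⟩
  | cupFork hs _ _ d e ih _ => exact absurd (key hs (ih rfl)).1 (by simp)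
  | capLower hs _ _ d e ih _ => exact absurd (key hs (ih rfl)).1 (by simp)
  | capUpper hs _ _ d e ih _ => exact absurd (key hs (ih rfl)).1 (by simp)
  | _ => exact absurd hσ (by simp)

/-- This excludes the pieces around the outside of an arc `⊂`, which need a right half disk starting
there. Left half disks therefore merge only at arcs `⊃`. -/
theorem isEmpty_right_of_cup {s k i j : ℕ} (hs : (siteWord K)[s]? = some (.cup k)) :
    IsEmpty (HalfDisk (siteWord K) .right (nextCol (siteWord K) s) i j) := by
  refine ⟨fun d => ?_⟩
  rcases hK.right_halfDisk d rfl with ⟨p, h, -, -⟩ | ⟨h, -, -⟩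
  · exact absurd (hK.getElem?_of_next_cap hs h) (by simp)
  · exact absurd (hK.getElem?_of_next_special hs h) (by simp)

omit hK in
theorem nextCol_inj {s t : ℕ} {ℓ ℓ' : Letter} (hs : (siteWord K)[s]? = some ℓ)
    (ht : (siteWord K)[t]? = some ℓ') (h : nextCol (siteWord K) s = nextCol (siteWord K) t) :
    s = t := by
  have h1 := (List.getElem?_eq_some_iff.mp hs).1
  have h2 := (List.getElem?_eq_some_iff.mp ht).1
  unfold nextCol at h
  rcases Nat.lt_or_ge (s + 1) (siteWord K).length with h3 | h3 <;>
    rcases Nat.lt_or_ge (t + 1) (siteWord K).length with h4 | h4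
  · rw [Nat.mod_eq_of_lt h3, Nat.mod_eq_of_lt h4] at h; omega
  · rw [show t + 1 = (siteWord K).length by omega, Nat.mod_self, Nat.mod_eq_of_lt h3] at h; omega
  · rw [show s + 1 = (siteWord K).length by omega, Nat.mod_self, Nat.mod_eq_of_lt h4] at h; omega
  · omega

/-! ### Left half disks -/

end IsClosed

/-- The left half disks that end in a strip, or in a strip with a corner, at a normal crossing. -/
abbrev CrossPieces (W : List Letter) (s k i j : ℕ) : Type :=
  (PLift (swapAt k i < swapAt k j ∧ i < j) × HalfDisk W .left s (swapAt k i) (swapAt k j)) ⊕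
  (PLift (i = k + 1 ∧ k + 1 < j) × HalfDisk W .left s (k + 1) j) ⊕
  (PLift (j = k ∧ i < k) × HalfDisk W .left s i k)

/-- Assembling the pieces at a normal crossing. -/
def CrossPieces.glue {W : List Letter} {s k i j : ℕ} (hs : W[s]? = some (.cross k .normal)) :
    CrossPieces W s k i j → HalfDisk W .left (nextCol W s) i j
  | .inl (h, d) => .stripL _ hs (Site.swapAt_swapAt k i).symm (Site.swapAt_swapAt k j).symm
      h.down.1 h.down.2 d
  | .inr (.inl (h, d)) => h.down.1.symm ▸ .lowerCornerL hs h.down.2 d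
  | .inr (.inr (h, d)) => h.down.1.symm ▸ .upperCornerL hs h.down.2 d

theorem CrossPieces.glue_injective {W : List Letter} {s k i j : ℕ}
    (hs : W[s]? = some (.cross k .normal)) :
    Function.Injective (CrossPieces.glue (i := i) (j := j) hs) := by
  rintro (⟨⟨h⟩, d⟩ | ⟨⟨⟨rfl, h⟩⟩, d⟩ | ⟨⟨⟨rfl, h⟩⟩, d⟩)
    (⟨⟨h'⟩, d'⟩ | ⟨⟨⟨h1, h'⟩⟩, d'⟩ | ⟨⟨⟨h1, h'⟩⟩, d'⟩) e
  · obtain ⟨-, -, -, e⟩ := HalfDisk.stripL.inj e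
    rw [eq_of_heq e]
  · subst h1; simp [glue] at e
  · subst h1; simp [glue] at e
  · simp [glue] at e
  · simp only [glue, HalfDisk.lowerCornerL.injEq] at e
    simp_all
  · omega
  · simp [glue] at e
  · omega
  · simp only [glue, HalfDisk.upperCornerL.injEq] at e
    simp_all

/-- The old number of strand `i` before two strands have been inserted in positions `k`, `k + 1`. -/
def dropAt (k i : ℕ) : ℕ := if i < k then i else i - 2

theorem dropAt_liftAt (k i : ℕ) : dropAt k (liftAt k i) = i := by
  unfold dropAt liftAt; split_ifs <;> omega

/-- The left half disks that end at a `cup`. -/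
abbrev CupPieces (W : List Letter) (s k i j : ℕ) : Type :=
  (PLift (i = liftAt k (dropAt k i) ∧ j = liftAt k (dropAt k j) ∧ dropAt k i < dropAt k j ∧ i < j) ×
    HalfDisk W .left s (dropAt k i) (dropAt k j)) ⊕ PLift (i = k ∧ j = k + 1)

/-- Assembling the pieces at a `cup`. -/
def CupPieces.glue {W : List Letter} {s k i j : ℕ} (hs : W[s]? = some (.cup k)) :
    CupPieces W s k i j → HalfDisk W .left (nextCol W s) i j
  | .inl (h, d) => .stripL _ hs h.down.1 h.down.2.1 h.down.2.2.1 h.down.2.2.2 d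
  | .inr h => h.down.1.symm ▸ h.down.2.symm ▸ .endCup hs

theorem CupPieces.glue_injective {W : List Letter} {s k i j : ℕ} (hs : W[s]? = some (.cup k)) :
    Function.Injective (CupPieces.glue (i := i) (j := j) hs) := by
  rintro (⟨⟨h⟩, d⟩ | ⟨rfl, rfl⟩) (⟨⟨h'⟩, d'⟩ | ⟨h1, h2⟩) e
  · obtain ⟨-, -, -, e⟩ := HalfDisk.stripL.inj e
    rw [eq_of_heq e]
  · subst h1 h2; simp [glue] at e
  · simp [glue] at e
  · rfl

/-- The left half disks that end at a `cap`. -/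
abbrev CapPieces (W : List Letter) (s k i j : ℕ) : Type :=
  (PLift (liftAt k i < liftAt k j ∧ i < j) × HalfDisk W .left s (liftAt k i) (liftAt k j)) ⊕
  (PLift (i < k ∧ k ≤ j) × (HalfDisk W .left s i k × HalfDisk W .left s (k + 1) (j + 2)))

/-- Assembling the pieces at a `cap`. -/
def CapPieces.glue {W : List Letter} {s k i j : ℕ} (hs : W[s]? = some (.cap k)) :
    CapPieces W s k i j → HalfDisk W .left (nextCol W s) i j
  | .inl (h, d) => .stripL (.cap k) hs rfl rfl h.down.1 h.down.2 d
  | .inr (h, d, e) => .capJoin hs h.down.1 h.down.2 d e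

theorem CapPieces.glue_injective {W : List Letter} {s k i j : ℕ} (hs : W[s]? = some (.cap k)) :
    Function.Injective (CapPieces.glue (i := i) (j := j) hs) := by
  rintro (⟨⟨h⟩, d⟩ | ⟨⟨h⟩, d, e⟩) (⟨⟨h'⟩, d'⟩ | ⟨⟨h'⟩, d', e'⟩) he
  · obtain ⟨-, -, -, e⟩ := HalfDisk.stripL.inj he
    rw [eq_of_heq e]
  · simp [glue] at he
  · simp [glue] at he
  · obtain ⟨-, e1, e2⟩ := HalfDisk.capJoin.inj he
    rw [eq_of_heq e1, eq_of_heq e2]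

namespace IsClosed

variable {K : List Site} (hK : IsClosed K)
include hK

-- A column has only one predecessor, so a left half disk just after the crossing ends with a piece
-- at that crossing. The column is generalized to a variable `c` so that the case analysis can unify
-- it with `nextCol`.
omit hK in
theorem crossPieces_glue_surjective {s k i j : ℕ}
    (hs : (siteWord K)[s]? = some (.cross k .normal)) :
    Function.Surjective (CrossPieces.glue (i := i) (j := j) hs) := by
  suffices H : ∀ c (hc : nextCol (siteWord K) s = c) (d : HalfDisk (siteWord K) .left c i j),
      ∃ x, hc ▸ CrossPieces.glue hs x = d from fun d => H _ rfl d
  intro c hc d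
  cases d with
  | @stripL t x y _ _ ℓ hs' hi hj hij hij' d =>
    obtain rfl := nextCol_inj hs hs' hc
    obtain rfl : Letter.cross k .normal = ℓ := by simpa [hs] using hs'
    obtain rfl : x = swapAt k i := by rw [show i = swapAt k x from hi, Site.swapAt_swapAt]
    obtain rfl : y = swapAt k j := by rw [show j = swapAt k y from hj, Site.swapAt_swapAt]
    exact ⟨.inl (⟨hij, hij'⟩, d), rfl⟩
  | lowerCornerL hs' hj d =>
    obtain rfl := nextCol_inj hs hs' hc
    simp only [hs, Option.some.injEq, Letter.cross.injEq, and_true] at hs'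
    subst hs'
    exact ⟨.inr (.inl (⟨rfl, hj⟩, d)), rfl⟩
  | upperCornerL hs' hi d =>
    obtain rfl := nextCol_inj hs hs' hc
    simp only [hs, Option.some.injEq, Letter.cross.injEq, and_true] at hs'
    subst hs'
    exact ⟨.inr (.inr (⟨rfl, hi⟩, d)), rfl⟩
  | endCornerL hs' => obtain rfl := nextCol_inj hs hs' hc; simp [hs] at hs'
  | endCup hs' => obtain rfl := nextCol_inj hs hs' hc; simp [hs] at hs'
  | cupLower hs' => obtain rfl := nextCol_inj hs hs' hc; simp [hs] at hs'
  | cupUpper hs' => obtain rfl := nextCol_inj hs hs' hc; simp [hs] at hs'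
  | capJoin hs' => obtain rfl := nextCol_inj hs hs' hc; simp [hs] at hs'

/-- Two of the constructors at an arc `⊂` contain a right half disk and are void; strips and the
inside of the arc remain. -/
theorem cupPieces_glue_surjective {s k i j : ℕ} (hs : (siteWord K)[s]? = some (.cup k)) :
    Function.Surjective (CupPieces.glue (i := i) (j := j) hs) := by
  suffices H : ∀ c (hc : nextCol (siteWord K) s = c) (d : HalfDisk (siteWord K) .left c i j),
      ∃ x, hc ▸ CupPieces.glue hs x = d from fun d => H _ rfl d
  intro c hc d
  cases d with
  | @stripL t x y _ _ ℓ hs' hi hj hij hij' d =>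
    obtain rfl := nextCol_inj hs hs' hc
    obtain rfl : Letter.cup k = ℓ := by simpa [hs] using hs'
    have hi : i = liftAt k x := hi
    have hj : j = liftAt k y := hj
    obtain rfl : x = dropAt k i := by rw [hi, dropAt_liftAt]
    obtain rfl : y = dropAt k j := by rw [hj, dropAt_liftAt]
    exact ⟨.inl (⟨hi, hj, hij, hij'⟩, d), rfl⟩
  | endCup hs' =>
    obtain rfl := nextCol_inj hs hs' hc
    simp only [hs, Option.some.injEq, Letter.cup.injEq] at hs'
    subst hs'
    exact ⟨.inr ⟨rfl, rfl⟩, rfl⟩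
  | lowerCornerL hs' => obtain rfl := nextCol_inj hs hs' hc; simp [hs] at hs'
  | upperCornerL hs' => obtain rfl := nextCol_inj hs hs' hc; simp [hs] at hs'
  | endCornerL hs' => obtain rfl := nextCol_inj hs hs' hc; simp [hs] at hs'
  | cupLower hs' _ _ _ e => exact (hK.isEmpty_right_of_cup hs').elim e
  | cupUpper hs' _ _ _ e => exact (hK.isEmpty_right_of_cup hs').elim e
  | capJoin hs' => obtain rfl := nextCol_inj hs hs' hc; simp [hs] at hs'

omit hK in
theorem capPieces_glue_surjective {s k i j : ℕ} (hs : (siteWord K)[s]? = some (.cap k)) :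
    Function.Surjective (CapPieces.glue (i := i) (j := j) hs) := by
  suffices H : ∀ c (hc : nextCol (siteWord K) s = c) (d : HalfDisk (siteWord K) .left c i j),
      ∃ x, hc ▸ CapPieces.glue hs x = d from fun d => H _ rfl d
  intro c hc d
  cases d with
  | stripL ℓ hs' hi hj hij hij' d =>
    obtain rfl := nextCol_inj hs hs' hc
    obtain rfl : Letter.cap k = ℓ := by simpa [hs] using hs'
    obtain rfl := hi
    obtain rfl := hj
    exact ⟨.inl (⟨hij, hij'⟩, d), rfl⟩
  | capJoin hs' hi hj d e =>
    obtain rfl := nextCol_inj hs hs' hc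
    simp only [hs, Option.some.injEq, Letter.cap.injEq] at hs'
    subst hs'
    exact ⟨.inr (⟨hi, hj⟩, d, e), rfl⟩
  | lowerCornerL hs' => obtain rfl := nextCol_inj hs hs' hc; simp [hs] at hs'
  | upperCornerL hs' => obtain rfl := nextCol_inj hs hs' hc; simp [hs] at hs'
  | endCornerL hs' => obtain rfl := nextCol_inj hs hs' hc; simp [hs] at hs'
  | endCup hs' => obtain rfl := nextCol_inj hs hs' hc; simp [hs] at hs'
  | cupLower hs' => obtain rfl := nextCol_inj hs hs' hc; simp [hs] at hs'
  | cupUpper hs' => obtain rfl := nextCol_inj hs hs' hc; simp [hs] at hs'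

/-! ### Column zero -/

omit hK in
theorem labelAt_cross_ne_none {s k : ℕ} {ty : CrossingType}
    (hs : (siteWord K)[s]? = some (.cross k ty)) : labelAt K (s, k + 1) ≠ none := by
  obtain ⟨κ, hκ, hl⟩ := getElem?_siteWord.mp hs
  rw [labelAt_of_getElem? hκ]
  cases κ <;> simp only [Site.letter, Letter.cross.injEq, reduceCtorEq] at hl <;>
    obtain ⟨rfl, rfl⟩ := hl <;> simp only [Site.label, levelLabel, swapAt] <;>
    split_ifs <;> first | omega | simp

omit hK in
theorem special_of_letter {s k : ℕ} {κ : Site} (hs : K[s]? = some κ)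
    (h : κ.letter = .cross k .special) : K[s]? = some .special ∧ k = 0 := by
  cases κ <;> simp_all [Site.letter]

theorem nextCol_special {s : ℕ} (hs : K[s]? = some .special) : nextCol (siteWord K) s = 0 := by
  rw [nextCol, List.length_map, (hK.special_iff s).1 hs, Nat.mod_self]

/-- Strand numbers are unbounded in the encoding. But every left half disk grows out of an arc or a
corner, and its upper side then follows an actual strand, whose label is not `none`; in column zero
this leaves only strands `0` and `1`. -/
theorem left_halfDisk_real {σ : Side} {c i j : ℕ} (d : HalfDisk (siteWord K) σ c i j)
    (hσ : σ = .left) : i < j ∧ labelAt K (c, j) ≠ none := by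
  induction d with
  | stripL ℓ hs hi hj hij hij' d ih => exact ⟨hij', hK.labelAt_through hs hj ▸ (ih rfl).2⟩
  | @lowerCornerL s k j hs hj d ih =>
    have : Through (.cross k .normal) j j := by
      simp only [Through, swapAt]; split_ifs <;> omega
    exact ⟨hj, hK.labelAt_through hs this ▸ (ih rfl).2⟩
  | @upperCornerL s k i hs hi d ih =>
    have : Through (.cross k .normal) (k + 1) k := by simp [Through, swapAt]
    refine ⟨hi, hK.labelAt_through hs this ▸ ?_⟩
    exact labelAt_cross_ne_none hs
  | endCornerL hs =>
    obtain ⟨κ, hκ, hl⟩ := getElem?_siteWord.mp hs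
    have h0 := special_of_letter hκ hl
    refine ⟨by omega, ?_⟩
    rw [h0.2, hK.nextCol_special h0.1, hK.labelAt_zero]
    simp [levelLabel]
  | endCup hs =>
    obtain ⟨m, -, h⟩ := hK.labelAt_cup hs
    exact ⟨by omega, by simp [h]⟩
  | cupLower hs hi hj d e ih _ =>
    obtain ⟨m, h, -⟩ := hK.labelAt_cup hs
    exact ⟨hi, by simp [h]⟩
  | @cupUpper s k i j hs hi hj d e ih _ =>
    have : Through (.cup k) j (j + 2) := by
      simp only [Through, liftAt]; split_ifs <;> omega
    exact ⟨by omega, hK.labelAt_through hs this ▸ (ih rfl).2⟩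
  | @capJoin s k i j hs hi hj d e _ ih =>
    have : Through (.cap k) (j + 2) j := by
      simp only [Through, liftAt]; split_ifs <;> omega
    exact ⟨by omega, hK.labelAt_through hs this ▸ (ih rfl).2⟩
  | _ => exact absurd hσ (by simp)

/-- The only left half disk in column zero is the end piece at the special crossing. -/
theorem left_halfDisk_zero {i j : ℕ} (d : HalfDisk (siteWord K) .left 0 i j) : i = 0 ∧ j = 1 := by
  obtain ⟨h1, h2⟩ := hK.left_halfDisk_real d rfl
  rw [hK.labelAt_zero, levelLabel] at h2
  split_ifs at h2 with h3 h4
  · omega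
  · omega
  · exact absurd rfl h2

omit hK in
/-- The left half disk in column zero. -/
def endPiece {s i j : ℕ} (hs : (siteWord K)[s]? = some (.cross 0 .special))
    (h : PLift (i = 0 ∧ j = 1)) : HalfDisk (siteWord K) .left (nextCol (siteWord K) s) i j :=
  h.down.1.symm ▸ h.down.2.symm ▸ .endCornerL hs

theorem endPiece_surjective {s i j : ℕ} (hs : (siteWord K)[s]? = some (.cross 0 .special)) :
    Function.Surjective (endPiece (i := i) (j := j) hs) := by
  suffices H : ∀ c (hc : nextCol (siteWord K) s = c) (d : HalfDisk (siteWord K) .left c i j),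
      ∃ x, hc ▸ endPiece hs x = d from fun d => H _ rfl d
  obtain ⟨κ, hκ, hl⟩ := getElem?_siteWord.mp hs
  have h0 := hK.nextCol_special (special_of_letter hκ hl).1
  intro c hc d
  obtain ⟨hi0, hj0⟩ : i = 0 ∧ j = 1 := by
    obtain rfl : c = 0 := hc.symm.trans h0
    exact hK.left_halfDisk_zero d
  cases d with
  | @stripL t x y _ _ ℓ hs' hi hj hij hij' d =>
    obtain rfl := nextCol_inj hs hs' hc
    obtain rfl : Letter.cross 0 .special = ℓ := by simpa [hs] using hs'
    -- The special crossing exchanges the strands `0` and `1`, so no strip ends between them.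
    simp only [Through, swapAt] at hi hj
    split_ifs at hi hj <;> omega
  | endCornerL hs' =>
    obtain rfl := nextCol_inj hs hs' hc
    subst hi0
    exact ⟨⟨rfl, rfl⟩, rfl⟩
  | lowerCornerL hs' => obtain rfl := nextCol_inj hs hs' hc; simp [hs] at hs'
  | upperCornerL hs' => obtain rfl := nextCol_inj hs hs' hc; simp [hs] at hs'
  | endCup hs' => obtain rfl := nextCol_inj hs hs' hc; simp [hs] at hs'
  | cupLower hs' => obtain rfl := nextCol_inj hs hs' hc; simp [hs] at hs'
  | cupUpper hs' => obtain rfl := nextCol_inj hs hs' hc; simp [hs] at hs'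
  | capJoin hs' => obtain rfl := nextCol_inj hs hs' hc; simp [hs] at hs'

end IsClosed

end LegendrianSolidTorus

namespace LegendrianSolidTorus

/-! ### Evaluation of half disks in a commutative ring -/

variable {R : Type*} [CommRing R]

/-- The sum over the left half disks of the products of the weights of their corners. -/
noncomputable def leftSum {W : List Letter} (w : Vertex W → R) (c i j : ℕ) : R :=
  ∑ᶠ d : HalfDisk W .left c i j, (d.word.map w).prod

theorem finsum_plift_prod {P : Prop} [Decidable P] {D : Type*} (g : D → R) :
    ∑ᶠ x : PLift P × D, g x.2 = if P then ∑ᶠ d, g d else 0 := by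
  split_ifs with h
  · refine finsum_eq_of_bijective Prod.snd ⟨?_, fun d => ⟨(⟨h⟩, d), rfl⟩⟩ fun _ => rfl
    rintro ⟨⟨_⟩, d⟩ ⟨⟨_⟩, d'⟩ rfl
    rfl
  · have : IsEmpty (PLift P × D) := ⟨fun x => h x.1.down⟩
    exact finsum_of_isEmpty _

theorem finsum_sum_type {α β : Type*} [Finite α] [Finite β] (g : α ⊕ β → R) :
    ∑ᶠ x, g x = ∑ᶠ a, g (.inl a) + ∑ᶠ b, g (.inr b) := by
  have := Fintype.ofFinite α
  have := Fintype.ofFinite β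
  simp [finsum_eq_sum_of_fintype]

theorem finsum_mul_finsum {α β : Type*} [Finite α] [Finite β] (f : α → R) (g : β → R) :
    ∑ᶠ x : α × β, f x.1 * g x.2 = (∑ᶠ a, f a) * ∑ᶠ b, g b := by
  have := Fintype.ofFinite α
  have := Fintype.ofFinite β
  simp [finsum_eq_sum_of_fintype, Fintype.sum_mul_sum, Fintype.sum_prod_type]

/-! ### Finiteness and transfer rules for left half disks. -/

namespace IsClosed

variable {K : List Site} (hK : IsClosed K) (w : Vertex (siteWord K) → R)

theorem finite_left_cross {s k : ℕ} (hs : (siteWord K)[s]? = some (.cross k .normal))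
    (hf : ∀ i j, Finite (HalfDisk (siteWord K) .left s i j)) (i j : ℕ) :
    Finite (HalfDisk (siteWord K) .left (nextCol (siteWord K) s) i j) :=
  have := hf
  .of_surjective _ (crossPieces_glue_surjective hs)

include hK in
theorem finite_left_cup {s k : ℕ} (hs : (siteWord K)[s]? = some (.cup k))
    (hf : ∀ i j, Finite (HalfDisk (siteWord K) .left s i j)) (i j : ℕ) :
    Finite (HalfDisk (siteWord K) .left (nextCol (siteWord K) s) i j) :=
  have := hf
  .of_surjective _ (hK.cupPieces_glue_surjective hs)

theorem finite_left_cap {s k : ℕ} (hs : (siteWord K)[s]? = some (.cap k))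
    (hf : ∀ i j, Finite (HalfDisk (siteWord K) .left s i j)) (i j : ℕ) :
    Finite (HalfDisk (siteWord K) .left (nextCol (siteWord K) s) i j) :=
  have := hf
  .of_surjective _ (capPieces_glue_surjective hs)

-- Column zero has at most the end piece at the special crossing, so the recursion does not run in a
-- circle; each later column gets its half disks from finitely many in the column before.
include hK in
theorem finite_left (c : ℕ) (hc : c < K.length) :
    ∀ i j, Finite (HalfDisk (siteWord K) .left c i j) := by
  induction c with
  | zero =>
    intro i j
    have h1 : K.length - 1 + 1 = K.length := Nat.sub_add_cancel hK.pos
    have h2 := (hK.special_iff (K.length - 1)).2 h1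
    rw [← hK.nextCol_special h2]
    exact .of_surjective _ (hK.endPiece_surjective (getElem?_siteWord.mpr ⟨_, h2, rfl⟩))
  | succ s ih =>
    have ih := ih (by omega)
    have hs : K[s]? = some K[s] := by simp
    have hw : (siteWord K)[s]? = some K[s].letter := getElem?_siteWord.mpr ⟨_, hs, rfl⟩
    rw [← nextCol_eq hc]
    generalize K[s] = κ at *
    cases κ with
    | cup q => exact hK.finite_left_cup hw ih
    | cap p => exact finite_left_cap hw ih
    | special => have := (hK.special_iff s).1 hs; omega
    | _ => exact finite_left_cross hw ih

include hK in
theorem leftSum_zero {s : ℕ} (hs : (siteWord K)[s]? = some (.cross 0 .special)) (i j : ℕ) :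
    leftSum w 0 i j = if i = 0 ∧ j = 1 then w (mkVertex hs) else 0 := by
  obtain ⟨κ, hκ, hl⟩ := getElem?_siteWord.mp hs
  have h0 := hK.nextCol_special (special_of_letter hκ hl).1
  suffices H : leftSum w (nextCol (siteWord K) s) i j =
      if i = 0 ∧ j = 1 then w (mkVertex hs) else 0 by rwa [h0] at H
  rw [leftSum]
  split_ifs with h
  · obtain ⟨rfl, rfl⟩ := h
    have : Function.Bijective (endPiece (i := 0) (j := 1) hs) :=
      ⟨fun ⟨_⟩ ⟨_⟩ _ => rfl, hK.endPiece_surjective hs⟩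
    rw [← finsum_eq_of_bijective (f := fun x => ((endPiece hs x).word.map w).prod) _ this
      fun _ => rfl]
    have : Unique (PLift ((0 : ℕ) = 0 ∧ (1 : ℕ) = 1)) := ⟨⟨⟨rfl, rfl⟩⟩, fun _ => rfl⟩
    rw [finsum_unique]
    simp [endPiece, HalfDisk.word]
  · have : IsEmpty (HalfDisk (siteWord K) .left (nextCol (siteWord K) s) i j) :=
      ⟨fun d => h (hK.endPiece_surjective hs d).choose.down⟩
    exact finsum_of_isEmpty _

/-- The terms are a strip and the two kinds of corner. As weights commute, it does not matter at
which end of the word the corner stands. -/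
theorem leftSum_cross {s k : ℕ} (hs : (siteWord K)[s]? = some (.cross k .normal))
    (hf : ∀ i j, Finite (HalfDisk (siteWord K) .left s i j)) (i j : ℕ) :
    leftSum w (nextCol (siteWord K) s) i j =
      (if swapAt k i < swapAt k j ∧ i < j then leftSum w s (swapAt k i) (swapAt k j) else 0) +
      ((if i = k + 1 ∧ k + 1 < j then w (mkVertex hs) * leftSum w s (k + 1) j else 0) +
      (if j = k ∧ i < k then w (mkVertex hs) * leftSum w s i k else 0)) := by
  have := hf
  rw [leftSum, ← finsum_eq_of_bijective (f := fun x => ((CrossPieces.glue hs x).word.map w).prod)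
    _ ⟨CrossPieces.glue_injective hs, crossPieces_glue_surjective hs⟩ fun _ => rfl,
    finsum_sum_type, finsum_sum_type]
  simp only [leftSum]
  have hmul : ∀ i j, w (mkVertex hs) * ∑ᶠ d : HalfDisk (siteWord K) .left s i j,
      (d.word.map w).prod = ∑ᶠ d : HalfDisk (siteWord K) .left s i j,
      w (mkVertex hs) * (d.word.map w).prod := fun i j => mul_finsum' _ _ (Set.toFinite _)
  rw [hmul, hmul, ← finsum_plift_prod, ← finsum_plift_prod, ← finsum_plift_prod]
  congr 2
  · refine finsum_congr ?_
    rintro ⟨⟨rfl, h⟩, d⟩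
    simp [CrossPieces.glue, HalfDisk.word, mul_comm]
  · refine finsum_congr ?_
    rintro ⟨⟨rfl, h⟩, d⟩
    simp [CrossPieces.glue, HalfDisk.word]

include hK in
theorem leftSum_cup {s k : ℕ} (hs : (siteWord K)[s]? = some (.cup k))
    (hf : ∀ i j, Finite (HalfDisk (siteWord K) .left s i j)) (i j : ℕ) :
    leftSum w (nextCol (siteWord K) s) i j =
      (if i = liftAt k (dropAt k i) ∧ j = liftAt k (dropAt k j) ∧ dropAt k i < dropAt k j ∧ i < j then
        leftSum w s (dropAt k i) (dropAt k j) else 0) + (if i = k ∧ j = k + 1 then 1 else 0) := by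
  have := hf
  rw [leftSum, ← finsum_eq_of_bijective (f := fun x => ((CupPieces.glue hs x).word.map w).prod)
    _ ⟨CupPieces.glue_injective hs, hK.cupPieces_glue_surjective hs⟩ fun _ => rfl, finsum_sum_type]
  simp only [leftSum]
  rw [← finsum_plift_prod]
  congr 1
  split_ifs with h
  · obtain ⟨rfl, rfl⟩ := h
    have : Unique (PLift (i = i ∧ i + 1 = i + 1)) := ⟨⟨⟨rfl, rfl⟩⟩, fun _ => rfl⟩
    rw [finsum_unique]
    simp [CupPieces.glue, HalfDisk.word]
  · have : IsEmpty (PLift (i = k ∧ j = k + 1)) := ⟨fun x => h x.down⟩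
    exact finsum_of_isEmpty _

/-- The quadratic term comes from pairs of half disks, below and above the arc, that merge on its
right. -/
theorem leftSum_cap {s k : ℕ} (hs : (siteWord K)[s]? = some (.cap k))
    (hf : ∀ i j, Finite (HalfDisk (siteWord K) .left s i j)) (i j : ℕ) :
    leftSum w (nextCol (siteWord K) s) i j =
      (if liftAt k i < liftAt k j ∧ i < j then leftSum w s (liftAt k i) (liftAt k j) else 0) +
      (if i < k ∧ k ≤ j then leftSum w s i k * leftSum w s (k + 1) (j + 2) else 0) := by
  have := hf
  rw [leftSum, ← finsum_eq_of_bijective (f := fun x => ((CapPieces.glue hs x).word.map w).prod)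
    _ ⟨CapPieces.glue_injective hs, capPieces_glue_surjective hs⟩ fun _ => rfl, finsum_sum_type]
  simp only [leftSum]
  rw [← finsum_mul_finsum, ← finsum_plift_prod, ← finsum_plift_prod]
  congr 1
  refine finsum_congr ?_
  rintro ⟨h, d, e⟩
  simp [CapPieces.glue, HalfDisk.word, mul_comm]

end IsClosed

end LegendrianSolidTorus

namespace LegendrianSolidTorus

variable {R : Type*} [CommRing R]

/-! ### Evaluation of disks -/

/-- The sum over the disks with positive corner `a` of the products of the weights of their negative
corners. -/
noncomputable def diskSum {W : List Letter} (w : Vertex W → R) (a : Vertex W) : R :=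
  ∑ᶠ d : Disk W a, (d.word.map w).prod

/-- The sum over the right half disks of the products of the weights of their corners. -/
noncomputable def rightSum {W : List Letter} (w : Vertex W → R) (c i j : ℕ) : R :=
  ∑ᶠ d : HalfDisk W .right c i j, (d.word.map w).prod

theorem mkVertex_inj {W : List Letter} {s t k l : ℕ} {ty ty' : CrossingType}
    {hs : W[s]? = some (.cross k ty)} {ht : W[t]? = some (.cross l ty')}
    (h : mkVertex hs = mkVertex ht) : s = t := by
  simpa [mkVertex] using h

/-- The strand numbers enter through equations so that `cases` can treat them as variables. Strands
that end in the arc bound no strip, and the pieces with three edges have different edges. -/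
theorem halfDisk_right_cap {W : List Letter} {c k i j : ℕ} (hc : W[c]? = some (.cap k))
    (hi : k = i) (hj : k + 1 = j) (d : HalfDisk W .right c i j) :
    d = hi ▸ hj ▸ HalfDisk.endCap hc := by
  cases d with
  | stripR ℓ hs hi' hj' =>
    obtain rfl : Letter.cap k = ℓ := by simpa [hc] using hs
    simp only [Through, liftAt] at hi'
    split_ifs at hi' <;> omega
  | endCap hs => subst hi; rfl
  | lowerCornerR hs => simp [hc] at hs
  | upperCornerR hs => simp [hc] at hs
  | endCornerR hs => simp [hc] at hs
  | cupFork hs => simp [hc] at hs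
  | capLower hs => simp [hc] at hs; omega
  | capUpper hs => simp [hc] at hs; omega

theorem halfDisk_right_special {W : List Letter} {c k i j : ℕ}
    (hc : W[c]? = some (.cross k .special)) (hi : k = i) (hj : k + 1 = j)
    (d : HalfDisk W .right c i j) : d = hi ▸ hj ▸ HalfDisk.endCornerR hc := by
  cases d with
  | stripR ℓ hs hi' hj' =>
    obtain rfl : Letter.cross k .special = ℓ := by simpa [hc] using hs
    simp only [Through, swapAt] at hi' hj'
    split_ifs at hi' hj' <;> omega
  | endCornerR hs => subst hi; rfl
  | endCap hs => simp [hc] at hs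
  | lowerCornerR hs => simp [hc] at hs
  | upperCornerR hs => simp [hc] at hs
  | cupFork hs => simp [hc] at hs
  | capLower hs => simp [hc] at hs
  | capUpper hs => simp [hc] at hs

theorem rightSum_cap {W : List Letter} (w : Vertex W → R) {c k : ℕ} (hc : W[c]? = some (.cap k)) :
    rightSum w c k (k + 1) = 1 := by
  have : Unique (HalfDisk W .right c k (k + 1)) :=
    ⟨⟨.endCap hc⟩, fun d => halfDisk_right_cap hc rfl rfl d⟩
  rw [rightSum, finsum_unique, halfDisk_right_cap hc rfl rfl default]
  simp [HalfDisk.word]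

theorem rightSum_special {W : List Letter} (w : Vertex W → R) {c k : ℕ}
    (hc : W[c]? = some (.cross k .special)) : rightSum w c k (k + 1) = w (mkVertex hc) := by
  have : Unique (HalfDisk W .right c k (k + 1)) :=
    ⟨⟨.endCornerR hc⟩, fun d => halfDisk_right_special hc rfl rfl d⟩
  rw [rightSum, finsum_unique, halfDisk_right_special hc rfl rfl default]
  simp [HalfDisk.word]

/-- Disks with positive corner at a normal crossing. -/
def diskGlue {W : List Letter} {s k : ℕ} (hs : W[s]? = some (.cross k .normal)) :
    HalfDisk W .left s k (k + 1) ⊕ HalfDisk W .right (nextCol W s) k (k + 1) →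
      Disk W (mkVertex hs)
  | .inl d => .leftQuadrant hs d
  | .inr d => .rightQuadrant hs d

theorem diskGlue_bijective {W : List Letter} {s k : ℕ} (hs : W[s]? = some (.cross k .normal)) :
    Function.Bijective (diskGlue hs) := by
  constructor
  · rintro (d | d) (d' | d') e
    · simp only [diskGlue, Disk.leftQuadrant.injEq] at e; rw [e]
    · simp [diskGlue] at e
    · simp [diskGlue] at e
    · simp only [diskGlue, Disk.rightQuadrant.injEq] at e; rw [e]
  · suffices H : ∀ a (ha : mkVertex hs = a) (d : Disk W a), ∃ x, ha ▸ diskGlue hs x = d from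
      fun d => H _ rfl d
    intro a ha d
    cases d with
    | leftQuadrant hs' d =>
      obtain rfl := mkVertex_inj ha
      obtain ⟨rfl⟩ : k = _ := by simpa [hs] using hs'
      exact ⟨.inl d, rfl⟩
    | rightQuadrant hs' d =>
      obtain rfl := mkVertex_inj ha
      obtain ⟨rfl⟩ : k = _ := by simpa [hs] using hs'
      exact ⟨.inr d, rfl⟩
    | upperQuadrant hs' => obtain rfl := mkVertex_inj ha; simp [hs] at hs'
    | lowerQuadrant hs' => obtain rfl := mkVertex_inj ha; simp [hs] at hs'

namespace IsClosed

variable {K : List Site} (hK : IsClosed K) (w : Vertex (siteWord K) → R)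
include hK

theorem finite_right (c i j : ℕ) : Finite (HalfDisk (siteWord K) .right c i j) := by
  rcases isEmpty_or_nonempty (HalfDisk (siteWord K) .right c i j) with h | ⟨⟨d⟩⟩
  · infer_instance
  · rcases hK.right_halfDisk d rfl with ⟨p, h, rfl, rfl⟩ | ⟨h, rfl, rfl⟩
    · have hs : (siteWord K)[c]? = some (.cap (2 * p + 1)) := getElem?_siteWord.mpr ⟨_, h, rfl⟩
      have : Subsingleton (HalfDisk (siteWord K) .right c (2 * p + 1) (2 * p + 2)) :=
        ⟨fun d d' => (halfDisk_right_cap hs rfl rfl d).trans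
          (halfDisk_right_cap hs rfl rfl d').symm⟩
      infer_instance
    · have hs : (siteWord K)[c]? = some (.cross 0 .special) := getElem?_siteWord.mpr ⟨_, h, rfl⟩
      have : Subsingleton (HalfDisk (siteWord K) .right c 0 1) :=
        ⟨fun d d' => (halfDisk_right_special hs rfl rfl d).trans
          (halfDisk_right_special hs rfl rfl d').symm⟩
      infer_instance

/-- A positive corner here fills the upper or lower quadrant and needs a right half disk in the next
column; but right half disks are preceded only by normal crossings. -/
theorem isEmpty_disk_special {s k : ℕ} (hs : (siteWord K)[s]? = some (.cross k .special)) :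
    IsEmpty (Disk (siteWord K) (mkVertex hs)) := by
  obtain ⟨κ, hκ, hl⟩ := getElem?_siteWord.mp hs
  have h0 := special_of_letter hκ hl
  have hz : ∀ i j, HalfDisk (siteWord K) .right (nextCol (siteWord K) s) i j → False := by
    intro i j d
    rcases hK.right_halfDisk d rfl with ⟨p, h, -, -⟩ | ⟨h, -, -⟩
    · exact absurd (hK.getElem?_of_next_cap hs h) (by simp)
    · exact absurd (hK.getElem?_of_next_special hs h) (by simp)
  suffices H : ∀ a (ha : mkVertex hs = a) (d : Disk (siteWord K) a), False from ⟨fun d => H _ rfl d⟩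
  intro a ha d
  cases d with
  | leftQuadrant hs' d => obtain rfl := mkVertex_inj ha; simp [hs] at hs'
  | rightQuadrant hs' d => obtain rfl := mkVertex_inj ha; simp [hs] at hs'
  | upperQuadrant hs' _ _ e => obtain rfl := mkVertex_inj ha; exact hz _ _ e
  | lowerQuadrant hs' _ _ e => obtain rfl := mkVertex_inj ha; exact hz _ _ e

theorem diskSum_normal {s k : ℕ} (hs : (siteWord K)[s]? = some (.cross k .normal)) :
    diskSum w (mkVertex hs) =
      leftSum w s k (k + 1) + rightSum w (nextCol (siteWord K) s) k (k + 1) := by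
  have := hK.finite_left s (by simpa using (List.getElem?_eq_some_iff.mp hs).1) k (k + 1)
  have := hK.finite_right (nextCol (siteWord K) s) k (k + 1)
  rw [diskSum, ← finsum_eq_of_bijective (f := fun x => ((diskGlue hs x).word.map w).prod)
    _ (diskGlue_bijective hs) fun _ => rfl, finsum_sum_type]
  rfl

omit hK in
theorem exists_mkVertex (a : Vertex (siteWord K)) :
    ∃ k ty, ∃ hs : (siteWord K)[(a.1 : ℕ)]? = some (.cross k ty), mkVertex hs = a := by
  have h := isCross_siteOf a
  have h2 := getElem?_siteWord.mpr ⟨_, getElem?_vertex a, rfl⟩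
  generalize (siteOf a).letter = ℓ at h h2
  cases ℓ with
  | cross k ty => exact ⟨k, ty, h2, rfl⟩
  | cup k => simp [Letter.isCross] at h
  | cap k => simp [Letter.isCross] at h

theorem finite_disk (a : Vertex (siteWord K)) : Finite (Disk (siteWord K) a) := by
  obtain ⟨k, ty, hs, ha⟩ := exists_mkVertex a
  rw [← ha]
  cases ty with
  | normal =>
    have := hK.finite_left a.1 (by simpa using a.1.2) k (k + 1)
    have := hK.finite_right (nextCol (siteWord K) a.1) k (k + 1)
    exact .of_surjective _ (diskGlue_bijective hs).2
  | special =>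
    have := hK.isEmpty_disk_special hs
    infer_instance

omit hK in
theorem vertex_letter (a : Vertex (siteWord K)) :
    (siteWord K)[(a.1 : ℕ)]? = some (siteOf a).letter :=
  getElem?_siteWord.mpr ⟨_, getElem?_vertex a, rfl⟩

theorem diskSum_of_site_special (a : Vertex (siteWord K)) (h : siteOf a = .special) :
    diskSum w a = 0 := by
  have hs := vertex_letter a
  rw [h] at hs
  have : IsEmpty (Disk (siteWord K) a) := hK.isEmpty_disk_special hs
  exact finsum_of_isEmpty _

/-- The summand `1` is the inside of the small loop to the right of the crossing. -/
theorem diskSum_of_site_loop (a : Vertex (siteWord K)) {p : ℕ} (h : siteOf a = .loop p) :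
    diskSum w a = leftSum w a.1 (2 * p + 1) (2 * p + 2) + 1 := by
  have hs := vertex_letter a
  rw [h] at hs
  refine (hK.diskSum_normal w hs).trans ?_
  obtain ⟨κ, h', rfl⟩ := hK.next _ _ (getElem?_vertex a |>.trans (congrArg some h))
  rw [rightSum_cap w (getElem?_siteWord.mpr ⟨_, h', rfl⟩)]

/-- The second summand is the bigon between the two crossings of the transition tangle, with
negative corner at the special one. -/
theorem diskSum_of_site_last (a b : Vertex (siteWord K)) (h : siteOf a = .last)
    (hb : siteOf b = .special) : diskSum w a = leftSum w a.1 0 1 + w b := by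
  have hs := vertex_letter a
  rw [h] at hs
  refine (hK.diskSum_normal w hs).trans ?_
  obtain ⟨κ, h', rfl⟩ := hK.next _ _ (getElem?_vertex a |>.trans (congrArg some h))
  rw [rightSum_special w (getElem?_siteWord.mpr ⟨_, h', rfl⟩)]
  congr 2
  have h1 := (hK.special_iff _).1 h'
  have h2 := (hK.special_iff _).1 (getElem?_vertex b |>.trans (congrArg some hb))
  exact Subtype.ext (Fin.ext (show nextCol (siteWord K) a.1 = b.1 by omega))

/-- Right half disks start only directly after a loop or after `last`, so at any other normal
crossing the right quadrant contributes nothing. -/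
theorem diskSum_of_site_other (a : Vertex (siteWord K)) {k : ℕ}
    (hk : (siteOf a).letter = .cross k .normal) (h1 : ∀ p, siteOf a ≠ .loop p)
    (h2 : siteOf a ≠ .last) : diskSum w a = leftSum w a.1 k (k + 1) := by
  have hs := vertex_letter a
  rw [hk] at hs
  refine (hK.diskSum_normal w hs).trans ?_
  rw [add_eq_left]
  have : IsEmpty (HalfDisk (siteWord K) .right (nextCol (siteWord K) a.1) k (k + 1)) := by
    refine ⟨fun d => ?_⟩
    obtain ⟨κ, h', hn⟩ := hK.next _ _ (getElem?_vertex a)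
    generalize siteOf a = κ' at *
    rcases hK.right_halfDisk d rfl with ⟨p, h, -, -⟩ | ⟨h, -, -⟩ <;> rw [h] at h' <;>
      cases h' <;> cases κ' <;> simp_all [Site.Next, Site.LevelStart]
  exact finsum_of_isEmpty _

end IsClosed

end LegendrianSolidTorus

namespace LegendrianSolidTorus

variable {R : Type*} [CommRing R]

/-! ### The sums over the left half disks -/

/-- The sums over the left half disks at the beginning of level `p`, or between two full twists. -/
def levelState (p : ℕ) (T β : R) (i j : ℕ) : R :=
  if i = 0 ∧ j = 2 * p + 1 then β else if i + 1 = 2 * p ∧ j = 2 * p + 1 then T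
  else if i % 2 = 1 ∧ j = i + 1 ∧ j ≤ 2 * p then 1 else 0

/-- The sums over the left half disks in the middle of a full twist in level `p`. -/
def twistState (p : ℕ) (T β : R) (i j : ℕ) : R :=
  if i = 0 ∧ j = 2 * p ∧ p ≠ 0 then β else if i + 1 = 2 * p ∧ j = 2 * p then T
  else if i + 1 = 2 * p ∧ j = 2 * p + 1 then 1
  else if i % 2 = 1 ∧ j = i + 1 ∧ j < 2 * p then 1 else 0

/-- The sums over the left half disks after the vertical crossing below level `p + 1`. -/
def vertState (p : ℕ) (T β : R) (i j : ℕ) : R :=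
  if i = 2 * p + 1 ∧ j = 2 * p + 3 then (if p = 0 then T + β else T)
  else if i = 2 * p ∧ j = 2 * p + 3 then T
  else if i = 0 ∧ j = 2 * p + 3 then β
  else if i % 2 = 1 ∧ j = i + 1 ∧ j ≤ 2 * p + 2 then 1
  else if i + 1 = 2 * p ∧ j = 2 * p + 1 then 1
  else if i = 2 * p ∧ j = 2 * p + 2 then 1 else 0

/-- The sums over the left half disks before the `cap` that ends level `p + 1`. -/
def loopState (p : ℕ) (T β : R) (i j : ℕ) : R :=
  if i = 2 * p + 2 ∧ j = 2 * p + 3 then (if p = 0 then T + β else T)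
  else if i = 2 * p ∧ j = 2 * p + 3 then T
  else if i = 0 ∧ j = 2 * p + 3 then β
  else if i % 2 = 1 ∧ j = i + 1 ∧ j ≤ 2 * p then 1
  else if i + 1 = 2 * p ∧ j = 2 * p + 2 then 1
  else if i = 2 * p ∧ j = 2 * p + 1 then 1 else 0

/-- The effect of a normal crossing of weight `x` on the sums over the left half disks. -/
def crossStep (k : ℕ) (x : R) (F : ℕ → ℕ → R) (i j : ℕ) : R :=
  (if swapAt k i < swapAt k j ∧ i < j then F (swapAt k i) (swapAt k j) else 0) +
    ((if i = k + 1 ∧ k + 1 < j then x * F (k + 1) j else 0) +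
    (if j = k ∧ i < k then x * F i k else 0))

/-- The effect of a `cup` on the sums over the left half disks. -/
def cupStep (k : ℕ) (F : ℕ → ℕ → R) (i j : ℕ) : R :=
  (if i = liftAt k (dropAt k i) ∧ j = liftAt k (dropAt k j) ∧ dropAt k i < dropAt k j ∧ i < j then
    F (dropAt k i) (dropAt k j) else 0) + (if i = k ∧ j = k + 1 then 1 else 0)

/-- The effect of a `cap` on the sums over the left half disks. -/
def capStep (k : ℕ) (F : ℕ → ℕ → R) (i j : ℕ) : R :=
  (if liftAt k i < liftAt k j ∧ i < j then F (liftAt k i) (liftAt k j) else 0) +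
    (if i < k ∧ k ≤ j then F i k * F (k + 1) (j + 2) else 0)

/-- The cases are sorted by which sides of the half disk meet the crossing. Between the two crossing
strands the entry is zero, since a strip there would turn over; a corner adds `x` times an old row
or column to the interchanged one. -/
theorem crossStep_eq {k : ℕ} {x : R} {F G : ℕ → ℕ → R}
    (h0 : ∀ i j, j ≤ i → G i j = 0) (h1 : G k (k + 1) = 0)
    (h2 : ∀ j, k + 1 < j → G (k + 1) j = F k j + x * F (k + 1) j)
    (h3 : ∀ j, k + 1 < j → G k j = F (k + 1) j)
    (h4 : ∀ i, i < k → G i k = F i (k + 1) + x * F i k)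
    (h5 : ∀ i, i < k → G i (k + 1) = F i k)
    (h6 : ∀ i j, i < j → i ≠ k → i ≠ k + 1 → j ≠ k → j ≠ k + 1 → G i j = F i j) :
    crossStep k x F = G := by
  funext i j
  unfold crossStep swapAt
  grind

/-- The corner adds the old rows of strands `2 * p` and `2 * p + 1`. For `p = 0` the former belongs
to the bottom strand, which carries `β`. -/
theorem crossStep_vert (p : ℕ) (T β : R) :
    crossStep (2 * p) 1 (levelState (p + 1) T β) = vertState p T β := by
  apply crossStep_eq <;> intros <;> simp only [levelState, vertState] <;> grind (splits := 20)

theorem crossStep_loop (p : ℕ) (T β : R) :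
    crossStep (2 * p + 1) 0 (vertState p T β) = loopState p T β := by
  apply crossStep_eq <;> intros <;> simp only [loopState, vertState] <;> grind (splits := 20)

/-- The half disk of weight `1` between strands `2 * p - 1` and `2 * p` can turn at this crossing,
which adds `x` to `T`. -/
theorem crossStep_odd {p : ℕ} (hp : p ≠ 0) (T β x : R) :
    crossStep (2 * p) x (levelState p T β) = twistState p (T + x) β := by
  apply crossStep_eq <;> intros <;> simp only [levelState, twistState] <;> grind (splits := 20)

/-- A corner here could only multiply the entries `T` and `β`, and both products vanish; so the
crossing just moves the entries back. -/
theorem crossStep_even {p : ℕ} (hp : p ≠ 0) {T β x : R} (h : x * β = 0) (h' : x * T = 0) :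
    crossStep (2 * p) x (twistState p T β) = levelState p T β := by
  apply crossStep_eq <;> intros <;> simp only [levelState, twistState] <;> grind (splits := 20)

/-- Level zero has only two strands, so the single entry `β` lies between the crossing strands and
cannot pass. -/
theorem crossStep_levelState_zero (T β x : R) : crossStep 0 x (levelState 0 T β) = 0 := by
  apply crossStep_eq <;> intros <;> simp only [levelState, Pi.zero_apply] <;> grind

theorem crossStep_zero (k : ℕ) (x : R) : crossStep k x 0 = 0 := by
  apply crossStep_eq <;> simp

theorem cupStep_levelState (q : ℕ) (β : R) :
    cupStep (2 * q + 1) (levelState q 0 β) = levelState (q + 1) 0 β := by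
  funext i j
  simp only [cupStep, levelState, dropAt, liftAt]
  grind (splits := 20)

/-- Between strand `2 * p` and the top strand, `T` arrives once as a strip passing over the arc, and
once as a product with a half disk of weight `1` below the arc. These cancel, while `β` survives: as
a strip if `p > 0`, in the product if `p = 0`. -/
theorem capStep_loopState (p : ℕ) {T β : R} (hT : T + T = 0) :
    capStep (2 * p + 1) (loopState p T β) = levelState p 0 β := by
  funext i j
  simp only [capStep, liftAt, loopState, levelState]
  grind (splits := 20)

/-- The possible sums over the left half disks at the beginning of level `p`, or after a full
twist; in level zero, a full twist makes all of them vanish. -/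
def StartState (K : List Site) (I : Ideal R) (β : R) (p : ℕ) (F : ℕ → ℕ → R) : Prop :=
  (∃ T ∈ I, F = levelState p T β) ∨ (p = 0 ∧ F = 0 ∧ .even 0 ∈ K)

/-- The possible sums over the left half disks on the left of a site. -/
def SiteState (K : List Site) (I : Ideal R) (β : R) : Site → (ℕ → ℕ → R) → Prop
  | .cup q, F => F = levelState q 0 β
  | .odd p, F => StartState K I β p F
  | .even p, F => (p = 0 ∧ F = 0) ∨ (p ≠ 0 ∧ ∃ T ∈ I, F = twistState p T β)
  | .vert p, F => ∃ T ∈ I, F = levelState (p + 1) T β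
  | .loop p, F => ∃ T ∈ I, F = vertState p T β
  | .cap p, F => ∃ T ∈ I, F = loopState p T β
  | .last, F => StartState K I β 0 F
  | .special, _ => True

theorem StartState.siteState {K : List Site} {I : Ideal R} {β : R} {p : ℕ} {F : ℕ → ℕ → R}
    (h : StartState K I β p F) {κ : Site} (hκ : Site.LevelStart p κ) : SiteState K I β κ F := by
  rcases hκ with rfl | ⟨r, rfl, rfl⟩ | ⟨rfl, rfl⟩
  · exact h
  · rcases h with h | ⟨h, -⟩
    · exact h
    · omega
  · exact h

/-- Weights that vanish on the loops, are `1` on the vertical crossings, and lie in an ideal of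
square zero on the crossings between different components. The weights of the vertical crossings
may be replaced by the condition that the sums over the disks at the loops vanish. -/
structure IsLinearWeight {K : List Site} (w : Vertex (siteWord K) → R) (I : Ideal R) : Prop where
  add_self : ∀ x : R, x + x = 0
  mul_eq_zero : ∀ x ∈ I, ∀ y ∈ I, x * y = 0
  mixed : ∀ a, (siteOf a).overComp ≠ (siteOf a).underComp → w a ∈ I
  loop : ∀ a p, siteOf a = .loop p → w a = 0
  vert : (∀ a p, siteOf a = .vert p → w a = 1) ∨ ∀ a p, siteOf a = .loop p → diskSum w a = 0

namespace IsClosed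

variable {K : List Site} (hK : IsClosed K) {w : Vertex (siteWord K) → R} {I : Ideal R}
include hK

theorem leftSum_succ_cross {s k : ℕ} (h : s + 1 < K.length)
    (hs : (siteWord K)[s]? = some (.cross k .normal)) :
    leftSum w (s + 1) = crossStep k (w (mkVertex hs)) (leftSum w s) := by
  funext i j
  rw [← nextCol_eq h, leftSum_cross w hs (hK.finite_left s (by omega))]
  rfl

theorem leftSum_succ_cup {s k : ℕ} (h : s + 1 < K.length)
    (hs : (siteWord K)[s]? = some (.cup k)) :
    leftSum w (s + 1) = cupStep k (leftSum w s) := by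
  funext i j
  rw [← nextCol_eq h, hK.leftSum_cup w hs (hK.finite_left s (by omega))]
  rfl

theorem leftSum_succ_cap {s k : ℕ} (h : s + 1 < K.length)
    (hs : (siteWord K)[s]? = some (.cap k)) :
    leftSum w (s + 1) = capStep k (leftSum w s) := by
  funext i j
  rw [← nextCol_eq h, leftSum_cap w hs (hK.finite_left s (by omega))]
  rfl

omit hK in
theorem siteOf_mkVertex {s k : ℕ} {ty : CrossingType} {κ : Site} (hκ : K[s]? = some κ)
    (hs : (siteWord K)[s]? = some (.cross k ty)) : siteOf (mkVertex hs) = κ := by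
  have : K[s]? = some (siteOf (mkVertex hs)) := getElem?_vertex (mkVertex hs)
  simpa [hκ] using this.symm

/-- The disk sum at the following loop is `1`, from the inside of the arc, plus the weight of this
vertical crossing. If it vanishes, that weight is `1`. -/
theorem weight_vert (hw : IsLinearWeight w I) {s p : ℕ} {T β : R}
    (hκ : K[s]? = some (.vert p)) (hs : (siteWord K)[s]? = some (.cross (2 * p) .normal))
    (hF : leftSum w s = levelState (p + 1) T β) : w (mkVertex hs) = 1 := by
  rcases hw.vert with h | h
  · exact h _ p (siteOf_mkVertex hκ hs)
  · obtain ⟨κ, h', rfl⟩ := hK.next s _ hκ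
    have hlt : s + 1 < K.length := by
      have h1 := (List.getElem?_eq_some_iff.mp hκ).1
      by_contra h2
      have := (hK.special_iff s).2 (by omega)
      simp [hκ] at this
    rw [nextCol_eq hlt] at h'
    have hs' : (siteWord K)[s + 1]? = some (.cross (2 * p + 1) .normal) :=
      getElem?_siteWord.mpr ⟨_, h', rfl⟩
    have h0 := h _ p (siteOf_mkVertex h' hs')
    rw [hK.diskSum_of_site_loop w _ (siteOf_mkVertex h' hs')] at h0
    have h1 : leftSum w (s + 1) (2 * p + 1) (2 * p + 2) = w (mkVertex hs) := by
      rw [hK.leftSum_succ_cross hlt hs, hF]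
      simp only [crossStep, swapAt, levelState]
      generalize w (mkVertex hs) = x
      grind (splits := 20)
    have h2 : w (mkVertex hs) + 1 = 0 := h1 ▸ h0
    rw [eq_neg_of_add_eq_zero_left h2, neg_eq_of_add_eq_zero_left (hw.add_self 1)]

/-- The invariant runs once through the list. The zero state remembers that `.even 0` occurs, so
that at `last` the cases with and without twists in level zero can be told apart. -/
theorem siteState (hw : IsLinearWeight w I) {b : Vertex (siteWord K)} (hb : siteOf b = .special)
    (s : ℕ) : ∀ κ, K[s]? = some κ → SiteState K I (w b) κ (leftSum w s) := by
  have hbI : w b ∈ I := hw.mixed b (by rw [hb]; simp [Site.overComp, Site.underComp])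
  induction s with
  | zero =>
    intro κ h
    obtain ⟨κ', h', hκ⟩ := hK.getElem?_zero
    obtain rfl : κ = κ' := by simpa [h] using h'
    have hs := vertex_letter b
    rw [hb] at hs
    have h0 : leftSum w 0 = levelState 0 0 (w b) := by
      funext i j
      rw [hK.leftSum_zero w hs, show mkVertex hs = b from rfl]
      simp only [levelState]
      generalize w b = x
      clear * -
      grind
    rcases hκ with rfl | hκ
    · exact h0
    · exact StartState.siteState (.inl ⟨0, I.zero_mem, h0⟩) hκ
  | succ s ih =>
    intro κ' h'
    have hlt := (List.getElem?_eq_some_iff.mp h').1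
    have hs : K[s]? = some K[s] := by simp
    obtain ⟨κ'', h'', hn⟩ := hK.next s _ hs
    rw [nextCol_eq hlt, h'] at h''
    obtain rfl : κ' = κ'' := by simpa using h''
    have ih := ih _ hs
    have hl : (siteWord K)[s]? = some K[s].letter := getElem?_siteWord.mpr ⟨_, hs, rfl⟩
    generalize K[s] = κ at *
    cases κ with
    | cup q =>
      have : leftSum w (s + 1) = levelState (q + 1) 0 (w b) := by
        rw [hK.leftSum_succ_cup hlt hl, show leftSum w s = _ from ih, cupStep_levelState]
      rcases hn with rfl | hn
      · exact this
      · exact StartState.siteState (.inl ⟨0, I.zero_mem, this⟩) hn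
    | odd p =>
      obtain rfl : κ' = .even p := hn
      have hx : w (mkVertex hl) ∈ I :=
        hw.mixed _ (by rw [siteOf_mkVertex hs hl]; simp [Site.overComp, Site.underComp])
      have e := hK.leftSum_succ_cross (w := w) hlt hl
      by_cases hp : p = 0
      · subst hp
        refine .inl ⟨rfl, ?_⟩
        rcases ih with ⟨T, -, hT⟩ | ⟨-, hT, -⟩
        · rw [e, hT]; exact crossStep_levelState_zero _ _ _
        · rw [e, hT, crossStep_zero]
      · refine .inr ⟨hp, ?_⟩
        rcases ih with ⟨T, hTI, hT⟩ | ⟨h, -⟩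
        · refine ⟨_, I.add_mem hTI hx, ?_⟩
          rw [e, hT, crossStep_odd hp]
        · exact absurd h hp
    | even p =>
      have hx : w (mkVertex hl) ∈ I :=
        hw.mixed _ (by rw [siteOf_mkVertex hs hl]; simp [Site.overComp, Site.underComp])
      have e := hK.leftSum_succ_cross (w := w) hlt hl
      refine StartState.siteState ?_ hn
      rcases ih with ⟨rfl, hF⟩ | ⟨hp, T, hTI, hF⟩
      · exact .inr ⟨rfl, by rw [e, hF, crossStep_zero], List.mem_of_getElem? hs⟩
      · refine .inl ⟨T, hTI, ?_⟩
        rw [e, hF, crossStep_even hp (hw.mul_eq_zero _ hx _ hbI) (hw.mul_eq_zero _ hx _ hTI)]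
    | vert p =>
      obtain rfl : κ' = .loop p := hn
      obtain ⟨T, hTI, hF⟩ := ih
      refine ⟨T, hTI, ?_⟩
      rw [hK.leftSum_succ_cross hlt hl, hK.weight_vert hw hs hl hF, hF, crossStep_vert]
    | loop p =>
      obtain rfl : κ' = .cap p := hn
      obtain ⟨T, hTI, hF⟩ := ih
      refine ⟨T, hTI, ?_⟩
      rw [hK.leftSum_succ_cross hlt hl, hw.loop _ p (siteOf_mkVertex hs hl), hF, crossStep_loop]
    | cap p =>
      obtain ⟨T, hTI, hF⟩ := ih
      refine StartState.siteState (.inl ⟨0, I.zero_mem, ?_⟩) hn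
      rw [hK.leftSum_succ_cap hlt hl, hF, capStep_loopState p (hw.add_self T)]
    | last =>
      obtain rfl : κ' = .special := hn
      trivial
    | special =>
      have := (hK.special_iff s).1 hs
      omega

section

variable (hw : IsLinearWeight w I) {b : Vertex (siteWord K)} (hb : siteOf b = .special)
include hw hb

theorem weight_eq_one {a : Vertex (siteWord K)} {p : ℕ} (ha : siteOf a = .vert p) : w a = 1 := by
  have h1 := (getElem?_vertex a).trans (congrArg some ha)
  have hl := vertex_letter a
  rw [ha] at hl
  obtain ⟨T, -, hF⟩ := hK.siteState hw hb _ _ h1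
  exact hK.weight_vert hw h1 hl hF

theorem diskSum_even {a : Vertex (siteWord K)} {p : ℕ} (ha : siteOf a = .even p) :
    diskSum w a = 0 := by
  have h1 := (getElem?_vertex a).trans (congrArg some ha)
  rw [hK.diskSum_of_site_other w a (k := 2 * p) (by rw [ha]; rfl) (by simp [ha]) (by simp [ha])]
  rcases hK.siteState hw hb _ _ h1 with ⟨-, hF⟩ | ⟨hp, T, -, hF⟩
  · rw [hF]; rfl
  · rw [hF, twistState]
    grind

theorem diskSum_vert {a : Vertex (siteWord K)} {p : ℕ} (ha : siteOf a = .vert p) :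
    diskSum w a = 0 := by
  have h1 := (getElem?_vertex a).trans (congrArg some ha)
  rw [hK.diskSum_of_site_other w a (k := 2 * p) (by rw [ha]; rfl) (by simp [ha]) (by simp [ha])]
  obtain ⟨T, -, hF⟩ := hK.siteState hw hb _ _ h1
  rw [hF, levelState]
  grind

theorem diskSum_loop {a : Vertex (siteWord K)} {p : ℕ} (ha : siteOf a = .loop p) :
    diskSum w a = 0 := by
  have h1 := (getElem?_vertex a).trans (congrArg some ha)
  obtain ⟨T, -, hF⟩ := hK.siteState hw hb _ _ h1
  rw [hK.diskSum_of_site_loop w a ha, hF, vertState]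
  have := hw.add_self 1
  grind

/-- The left quadrant reads the entry `(2 * p, 2 * p + 1)`. It can be nonzero only in level zero,
where it lies between the bottom and the top strand and may equal `β`. -/
theorem diskSum_odd {a : Vertex (siteWord K)} {p : ℕ} (ha : siteOf a = .odd p) :
    diskSum w a = 0 ∨ p = 0 ∧ diskSum w a = w b := by
  have h1 := (getElem?_vertex a).trans (congrArg some ha)
  rw [hK.diskSum_of_site_other w a (k := 2 * p) (by rw [ha]; rfl) (by simp [ha]) (by simp [ha])]
  rcases hK.siteState hw hb _ _ h1 with ⟨T, -, hF⟩ | ⟨-, hF, -⟩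
  · rw [hF, levelState]
    split_ifs with h2 h3 h4
    · exact .inr ⟨by omega, rfl⟩
    · omega
    · omega
    · exact .inl rfl
  · rw [hF]; exact .inl rfl

/-- The half disk from the special crossing has survived all the way to `last`; its weight cancels
that of the bigon on the right. -/
theorem diskSum_last_of_notMem {a : Vertex (siteWord K)} (ha : siteOf a = .last)
    (h0 : .even 0 ∉ K) : diskSum w a = 0 := by
  have h1 := (getElem?_vertex a).trans (congrArg some ha)
  rw [hK.diskSum_of_site_last w a b ha hb]
  rcases hK.siteState hw hb _ _ h1 with ⟨T, -, hF⟩ | ⟨-, -, h⟩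
  · rw [hF]; simp [levelState, hw.add_self]
  · exact absurd h h0

/-- A twist in level zero has stopped the half disks coming from the left, so only the bigon on the
right remains. -/
theorem diskSum_last_of_even {a : Vertex (siteWord K)} (ha : siteOf a = .last) {s : ℕ}
    (hs : K[s]? = some (.even 0)) (has : (a.1 : ℕ) = s + 1) : diskSum w a = w b := by
  rw [hK.diskSum_of_site_last w a b ha hb, has]
  have hl : (siteWord K)[s]? = some (.cross 0 .normal) := getElem?_siteWord.mpr ⟨_, hs, rfl⟩
  have hlt : s + 1 < K.length := by
    have := a.1.2
    simp only [List.length_map] at this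
    omega
  rcases hK.siteState hw hb _ _ hs with ⟨-, hF⟩ | ⟨h, -⟩
  · rw [hK.leftSum_succ_cross hlt hl, hF, crossStep_zero]; simp
  · exact absurd rfl h

end

end IsClosed

end LegendrianSolidTorus

namespace LegendrianSolidTorus

/-! ### Augmentations -/

variable {R : Type*} [CommRing R]

/-- `ε ∘ ∂` is a derivation over `ε`, so generators suffice; the square-zero extension turns the
Leibniz rule into multiplicativity. -/
theorem map_leibniz_eq_zero {X : Type} {δ : X → FreeAlgebra (ZMod 2) X}
    {ε : FreeAlgebra (ZMod 2) X →ₐ[ZMod 2] ZMod 2} (h : ∀ a, ε (δ a) = 0)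
    (x : FreeAlgebra (ZMod 2) X) : ε (leibniz δ x) = 0 := by
  let Φ := FreeAlgebra.lift (ZMod 2) (fun a =>
    (TrivSqZeroExt.inl (FreeAlgebra.ι (ZMod 2) a) + TrivSqZeroExt.inr (δ a) :
      TrivSqZeroExt (FreeAlgebra (ZMod 2) X) (FreeAlgebra (ZMod 2) X)))
  change ε (Φ x).snd = 0
  induction x using FreeAlgebra.induction with
  | grade0 r => simp [AlgHom.commutes, TrivSqZeroExt.algebraMap_eq_inl']
  | grade1 a => simp [Φ, h]
  | mul x y hx hy => simp [hx, hy]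
  | add x y hx hy => simp [hx, hy]

theorem leibniz_ι {X : Type} (δ : X → FreeAlgebra (ZMod 2) X) (a : X) :
    leibniz δ (FreeAlgebra.ι (ZMod 2) a) = δ a := by
  simp [leibniz]

namespace IsClosed

variable {K : List Site} (hK : IsClosed K)
include hK

/-- A commutative target sees only products of weights and not the order of words. Finiteness of the
set of disks is what lets the map pass through `∑ᶠ`. -/
theorem map_boundary {S : Type*} [CommRing S] [Algebra (ZMod 2) S]
    (φ : FreeAlgebra (ZMod 2) (Vertex (siteWord K)) →ₐ[ZMod 2] S) (a : Vertex (siteWord K)) :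
    φ (boundary a) = diskSum (fun b => φ (FreeAlgebra.ι (ZMod 2) b)) a := by
  have := hK.finite_disk a
  rw [boundary, diskSum]
  refine (AddMonoidHom.map_finsum φ.toLinearMap.toAddMonoidHom (Set.toFinite _)).trans
    (finsum_congr fun d => ?_)
  simp [map_list_prod, Function.comp_def]

theorem inSplit_self_iff (a : Vertex (siteWord K)) (j : Fin 2) :
    InSplit j j a ↔ j = 0 ∧ (siteOf a).overComp = (siteOf a).underComp := by
  rw [hK.inSplit_iff]
  generalize siteOf a = κ
  cases κ <;> fin_cases j <;> simp [Site.overComp, Site.underComp]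

/-- `Λ₂` never crosses itself; the self-crossings of `Λ₁` are the vertical crossings and the loops.
-/
theorem site_of_inSplit {a : Vertex (siteWord K)} {j : Fin 2} (h : InSplit j j a) :
    j = 0 ∧ ((∃ p, siteOf a = .vert p) ∨ ∃ p, siteOf a = .loop p) := by
  rw [hK.inSplit_self_iff] at h
  have h3 := isCross_siteOf a
  refine ⟨h.1, ?_⟩
  have h := h.2
  generalize siteOf a = κ at *
  cases κ <;> simp_all [Site.overComp, Site.underComp, Site.letter, Letter.isCross]

/-- The differential of a component is evaluated by all disks, if the weights vanish on the
crossings between different components. -/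
theorem map_knotBoundary {j : Fin 2} (φ : FreeAlgebra (ZMod 2) (KnotVertex (siteWord K) j) →ₐ[ZMod 2]
      ZMod 2) {ε : Vertex (siteWord K) → ZMod 2}
    (h1 : ∀ a : KnotVertex (siteWord K) j, ε a.1 = φ (FreeAlgebra.ι (ZMod 2) a))
    (h0 : ∀ a, ¬ InSplit j j a → ε a = 0) (a : KnotVertex (siteWord K) j) :
    φ (knotBoundary a) = diskSum ε a.1 := by
  have := hK.finite_disk a.1
  rw [knotBoundary, diskSum]
  refine (AddMonoidHom.map_finsum φ.toLinearMap.toAddMonoidHom (Set.toFinite _)).trans ?_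
  have e1 : ∀ d : {d : Disk (siteWord K) a.1 // ∀ b ∈ d.word, InSplit j j b},
      φ ((d.1.word.attachWith (InSplit j j) d.2).map (FreeAlgebra.ι (ZMod 2))).prod =
        (d.1.word.map ε).prod := by
    intro d
    rw [map_list_prod, List.map_map]
    congr 1
    rw [show (φ : _ → ZMod 2) ∘ FreeAlgebra.ι (ZMod 2) = ε ∘ Subtype.val from
      funext fun b => (h1 b).symm, ← List.map_map, List.attachWith_map_subtype_val]
  refine (finsum_congr e1).trans ?_
  refine (finsum_subtype_eq_finsum_cond (f := fun d : Disk (siteWord K) a.1 =>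
    (d.word.map ε).prod) fun d => ∀ b ∈ d.word, InSplit j j b).trans ?_
  classical
  refine finsum_congr fun d => ?_
  by_cases hd : ∀ b ∈ d.word, InSplit j j b
  · rw [finsum_eq_if, if_pos hd]
  -- A disk with a corner off the component is not counted for the knot, and its product has a zero
  -- factor.
  · rw [finsum_eq_if, if_neg hd]
    push Not at hd
    obtain ⟨b, hb, hb'⟩ := hd
    exact (List.prod_eq_zero (List.mem_map.mpr ⟨b, hb, h0 b hb'⟩)).symm

theorem exists_special : ∃ b : Vertex (siteWord K), siteOf b = .special := by
  have h1 : K.length - 1 + 1 = K.length := Nat.sub_add_cancel hK.pos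
  have h2 := (hK.special_iff (K.length - 1)).2 h1
  have hs : (siteWord K)[K.length - 1]? = some (.cross 0 .special) :=
    getElem?_siteWord.mpr ⟨_, h2, rfl⟩
  exact ⟨mkVertex hs, siteOf_mkVertex h2 hs⟩

end IsClosed

/-- The weights of the augmentation. -/
def Site.aug : Site → ZMod 2
  | .vert _ => 1
  | _ => 0

/-- The augmentation of the link. -/
def linkAug {K : List Site} (a : Vertex (siteWord K)) : ZMod 2 := (siteOf a).aug

theorem linkAug_eq_zero {K : List Site} {a : Vertex (siteWord K)}
    (h : (siteOf a).overComp ≠ (siteOf a).underComp) : linkAug a = 0 := by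
  unfold linkAug
  generalize siteOf a = κ at *
  cases κ <;> simp_all [Site.overComp, Site.underComp, Site.aug]

/-! ### Existence and uniqueness of the augmentation. -/

namespace IsClosed

variable {K : List Site} (hK : IsClosed K)
include hK

omit hK in
theorem isLinearWeight_linkAug :
    IsLinearWeight (linkAug : Vertex (siteWord K) → ZMod 2) (⊥ : Ideal (ZMod 2)) where
  add_self x := CharTwo.add_self_eq_zero x
  mul_eq_zero x hx y hy := by rw [Ideal.mem_bot.mp hx, zero_mul]
  mixed a h := Ideal.mem_bot.mpr (linkAug_eq_zero h)
  loop a p h := by simp [linkAug, h, Site.aug]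
  vert := .inl fun a p h => by simp [linkAug, h, Site.aug]

theorem linkAug_eq_zero_of_not_inSplit {a : Vertex (siteWord K)} (h : ¬ InSplit 0 0 a) :
    linkAug a = 0 := by
  rw [hK.inSplit_self_iff] at h
  exact linkAug_eq_zero fun h' => h ⟨rfl, h'⟩

theorem isAugmentation_linkAug : IsAugmentation (linkAug : Vertex (siteWord K) → ZMod 2) := by
  obtain ⟨b, hb⟩ := hK.exists_special
  refine ⟨fun j => FreeAlgebra.lift (ZMod 2) fun a => linkAug a.1, fun j => ⟨?_, ?_⟩, by simp,
    fun a h => hK.linkAug_eq_zero_of_not_inSplit (h 0)⟩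
  · refine map_leibniz_eq_zero fun a => ?_
    obtain ⟨rfl, h⟩ := hK.site_of_inSplit a.2
    rw [hK.map_knotBoundary _ (ε := linkAug) (by simp)
      fun a h => hK.linkAug_eq_zero_of_not_inSplit h]
    rcases h with ⟨p, h⟩ | ⟨p, h⟩
    · exact hK.diskSum_vert isLinearWeight_linkAug hb h
    · exact hK.diskSum_loop isLinearWeight_linkAug hb h
  · intro l hl
    rw [map_list_prod, List.map_map]
    -- If the product is nonzero, all its factors come from vertical crossings, which have degree
    -- zero, so the total degree is zero.
    by_contra hne
    apply hl
    apply List.sum_eq_zero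
    intro d hd
    obtain ⟨a, ha, rfl⟩ := List.mem_map.mp hd
    have h1 : linkAug a.1 ≠ 0 := fun h => hne (List.prod_eq_zero
      (List.mem_map.mpr ⟨a, ha, by simpa using h⟩))
    rw [hK.degree_eq]
    rcases (hK.site_of_inSplit a.2).2 with ⟨p, h⟩ | ⟨p, h⟩
    · rw [h]; rfl
    · exact absurd (by simp [linkAug, h, Site.aug]) h1

/-- Loops have degree one and get value zero, as do mixed crossings by definition. The vanishing of
the disk sums at the loops then leaves only the value one for vertical crossings. -/
theorem eq_linkAug {ε : Vertex (siteWord K) → ZMod 2} (h : IsAugmentation ε) : ε = linkAug := by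
  obtain ⟨b, hb⟩ := hK.exists_special
  obtain ⟨φ, h1, h2, h3⟩ := h
  have hmixed : ∀ a, (siteOf a).overComp ≠ (siteOf a).underComp → ε a = 0 := fun a ha =>
    h3 a fun j hj => ha ((hK.inSplit_self_iff a j).1 hj).2
  have hloop : ∀ a p, siteOf a = .loop p → ε a = 0 := by
    intro a p ha
    have hs : InSplit 0 0 a := (hK.inSplit_self_iff a 0).2 ⟨rfl, by rw [ha]; rfl⟩
    rw [h2 0 ⟨a, hs⟩]
    have := (h1 0).2 [⟨a, hs⟩]
    simpa [hK.degree_eq, ha, Site.deg] using this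
  have hw : IsLinearWeight ε (⊥ : Ideal (ZMod 2)) :=
    { add_self := fun x => CharTwo.add_self_eq_zero x
      mul_eq_zero := fun x hx y hy => by rw [Ideal.mem_bot.mp hx, zero_mul]
      mixed := fun a ha => Ideal.mem_bot.mpr (hmixed a ha)
      loop := hloop
      vert := by
        refine .inr fun a p ha => ?_
        have hs : InSplit 0 0 a := (hK.inSplit_self_iff a 0).2 ⟨rfl, by rw [ha]; rfl⟩
        rw [← hK.map_knotBoundary (φ 0) (h2 0) (fun c hc => hmixed c fun h =>
          hc ((hK.inSplit_self_iff c 0).2 ⟨rfl, h⟩)) ⟨a, hs⟩, ← leibniz_ι knotBoundary]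
        exact (h1 0).1 _ }
  funext a
  by_cases ha : (siteOf a).overComp = (siteOf a).underComp
  · have hs : InSplit 0 0 a := (hK.inSplit_self_iff a 0).2 ⟨rfl, ha⟩
    rcases (hK.site_of_inSplit hs).2 with ⟨p, h⟩ | ⟨p, h⟩
    · rw [hK.weight_eq_one hw hb h]; simp [linkAug, h, Site.aug]
    · rw [hloop a p h]; simp [linkAug, h, Site.aug]
  · rw [hmixed a ha, linkAug_eq_zero ha]

end IsClosed

/-! ### The linearized differential -/

open Classical in
/-- The weights that compute the coefficient of `c` in the linearized differential. -/
noncomputable def dualWeight {X : Type} (ε : X → ZMod 2) (c a : X) : DualNumber (ZMod 2) :=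
  TrivSqZeroExt.inl (ε a) + TrivSqZeroExt.inr (if a = c then 1 else 0)

theorem basisFreeMonoid_apply {X : Type} (m : FreeMonoid X) :
    FreeAlgebra.basisFreeMonoid (ZMod 2) X m =
      (m.toList.map (FreeAlgebra.ι (ZMod 2))).prod := by
  have : FreeAlgebra.basisFreeMonoid (ZMod 2) X m =
      FreeMonoid.lift (FreeAlgebra.ι (ZMod 2)) m := by
    simp [FreeAlgebra.basisFreeMonoid, FreeAlgebra.equivMonoidAlgebraFreeMonoid]
  rw [this, FreeMonoid.lift_apply]

-- Write `η` for the square-zero unit. Under `c ↦ η` and all other generators `↦ 0`, words of length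
-- at least two vanish and the empty word has no `η`-part; only the word `c` is seen.
open Classical in
theorem snd_lift_single {X : Type} (c : X) (x : FreeAlgebra (ZMod 2) X) :
    (FreeAlgebra.lift (ZMod 2) (fun a => (TrivSqZeroExt.inr (if a = c then 1 else 0) :
      DualNumber (ZMod 2))) x).snd =
      (FreeAlgebra.basisFreeMonoid (ZMod 2) X).repr x (FreeMonoid.of c) := by
  let φ : FreeAlgebra (ZMod 2) X →ₐ[ZMod 2] DualNumber (ZMod 2) :=
    FreeAlgebra.lift (ZMod 2) fun a => TrivSqZeroExt.inr (if a = c then 1 else 0)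
  have hφ : ∀ a, φ (FreeAlgebra.ι (ZMod 2) a) = TrivSqZeroExt.inr (if a = c then 1 else 0) :=
    fun a => FreeAlgebra.lift_ι_apply _ _
  suffices H : (TrivSqZeroExt.sndHom (ZMod 2) (ZMod 2)).comp (φ : _ →ₗ[ZMod 2] _) =
      (FreeAlgebra.basisFreeMonoid (ZMod 2) X).coord (FreeMonoid.of c) from
    LinearMap.congr_fun H x
  refine (FreeAlgebra.basisFreeMonoid (ZMod 2) X).ext fun m => ?_
  rw [Module.Basis.coord_apply, Module.Basis.repr_self, LinearMap.comp_apply, basisFreeMonoid_apply]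
  change (φ (m.toList.map (FreeAlgebra.ι (ZMod 2))).prod).snd = _
  rw [map_list_prod, List.map_map, Finsupp.single_apply]
  rcases hm : m.toList with _ | ⟨a, _ | ⟨b, l⟩⟩
  · have : m ≠ FreeMonoid.of c := by rintro rfl; simp at hm
    simp [this]
  · have : m = FreeMonoid.of a := FreeMonoid.toList.injective (by simpa using hm)
    subst this
    simp only [List.map_cons, List.map_nil, List.prod_cons, List.prod_nil, mul_one,
      Function.comp_apply, hφ, TrivSqZeroExt.snd_inr]
    simp [FreeMonoid.of_injective.eq_iff]
  · have : m ≠ FreeMonoid.of c := by rintro rfl; simp at hm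
    simp only [List.map_cons, List.prod_cons, Function.comp_apply, hφ, ← mul_assoc,
      TrivSqZeroExt.inr_mul_inr, zero_mul, TrivSqZeroExt.snd_zero, if_neg this]

namespace IsClosed

variable {K : List Site} (hK : IsClosed K)
include hK

/-- Substituting `b + ε b` and then extracting the word `c` amounts to one algebra map to the dual
numbers, which turns the linearized differential into a weighted count of disks. -/
theorem linearCoeff_eq (ε : Vertex (siteWord K) → ZMod 2) (c a : Vertex (siteWord K)) :
    linearCoeff ε c a = (diskSum (dualWeight ε c) a).snd := by
  classical
  rw [linearCoeff, ← snd_lift_single, ← AlgHom.comp_apply, hK.map_boundary]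
  congr 2
  funext b
  simp [dualWeight, TrivSqZeroExt.algebraMap_eq_inl', add_comm]

-- As `c` joins different components, the infinitesimal change does not touch loops and vertical
-- crossings; the multiples of `η` form an ideal of square zero.
omit hK in
theorem isLinearWeight_dualWeight {c : Vertex (siteWord K)}
    (hc : (siteOf c).overComp ≠ (siteOf c).underComp) :
    IsLinearWeight (dualWeight linkAug c)
      (RingHom.ker (TrivSqZeroExt.fstHom (ZMod 2) (ZMod 2) (ZMod 2))) where
  add_self x := by ext <;> simp [CharTwo.add_self_eq_zero]
  mul_eq_zero x hx y hy := by
    have hx : x.fst = 0 := hx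
    have hy : y.fst = 0 := hy
    ext <;> simp [hx, hy]
  mixed a h := by
    change (dualWeight linkAug c a).fst = 0
    rw [dualWeight, linkAug_eq_zero h, TrivSqZeroExt.fst_add, TrivSqZeroExt.fst_inr]
    simp
  loop a p h := by
    have : a ≠ c := by rintro rfl; simp [h, Site.overComp, Site.underComp] at hc
    simp [dualWeight, this, linkAug, h, Site.aug]
  vert := .inl fun a p h => by
    have : a ≠ c := by rintro rfl; simp [h, Site.overComp, Site.underComp] at hc
    simp [dualWeight, this, linkAug, h, Site.aug]

section

variable {c : Vertex (siteWord K)} (hc : (siteOf c).overComp ≠ (siteOf c).underComp)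
include hc

theorem linearCoeff_even {a : Vertex (siteWord K)} {p : ℕ} (ha : siteOf a = .even p) :
    linearCoeff linkAug c a = 0 := by
  obtain ⟨b, hb⟩ := hK.exists_special
  rw [hK.linearCoeff_eq, hK.diskSum_even (isLinearWeight_dualWeight hc) hb ha]
  rfl

omit hc in
theorem linearCoeff_special {a : Vertex (siteWord K)} (ha : siteOf a = .special) :
    linearCoeff linkAug c a = 0 := by
  rw [hK.linearCoeff_eq, hK.diskSum_of_site_special _ a ha]
  rfl

variable {b : Vertex (siteWord K)} (hb : siteOf b = .special)
include hb

theorem linearCoeff_odd {a : Vertex (siteWord K)} {p : ℕ} (ha : siteOf a = .odd p)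
    (h : linearCoeff linkAug c a ≠ 0) : p = 0 ∧ c = b := by
  rw [hK.linearCoeff_eq] at h
  rcases hK.diskSum_odd (isLinearWeight_dualWeight hc) hb ha with h0 | ⟨hp, h0⟩
  · rw [h0] at h; exact absurd rfl h
  · refine ⟨hp, ?_⟩
    by_contra hcb
    rw [h0] at h
    simp [dualWeight, Ne.symm hcb] at h

theorem linearCoeff_last_of_notMem {a : Vertex (siteWord K)} (ha : siteOf a = .last)
    (h0 : .even 0 ∉ K) : linearCoeff linkAug c a = 0 := by
  rw [hK.linearCoeff_eq, hK.diskSum_last_of_notMem (isLinearWeight_dualWeight hc) hb ha h0]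
  rfl

open Classical in
theorem linearCoeff_last_of_even {a : Vertex (siteWord K)} (ha : siteOf a = .last) {s : ℕ}
    (hs : K[s]? = some (.even 0)) (has : (a.1 : ℕ) = s + 1) :
    linearCoeff linkAug c a = if b = c then 1 else 0 := by
  rw [hK.linearCoeff_eq, hK.diskSum_last_of_even (isLinearWeight_dualWeight hc) hb ha hs has,
    dualWeight, TrivSqZeroExt.snd_add, TrivSqZeroExt.snd_inr, TrivSqZeroExt.snd_inl, zero_add]
  split_ifs <;> rfl

end

end IsClosed

end LegendrianSolidTorus

namespace LegendrianSolidTorus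

/-! ### Betti numbers -/

section

variable {W : List Letter} {ε : Vertex W → ZMod 2} {j₁ j₂ : Fin 2}

open Classical in
theorem linearDifferential_eq_zero {k l : ℤ}
    (h : ∀ a c : Vertex W, InSplit j₁ j₂ a → InSplit j₁ j₂ c → degree a = k → degree c = l →
      linearCoeff ε c a = 0) : linearDifferential ε j₁ j₂ k l = 0 := by
  rw [linearDifferential]
  have : (Matrix.of fun b a => linearCoeff ε b.1 a.1 :
      Matrix (SplitVertex W j₁ j₂ l) (SplitVertex W j₁ j₂ k) (ZMod 2)) = 0 := by
    ext c a
    exact h a.1 c.1 a.2.1 c.2.1 a.2.2 c.2.2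
  rw [this, Matrix.mulVecLin_zero]

/-- The Betti numbers in terms of the ranks of the linearized differentials. -/
theorem betti_add (k : ℤ)
    (h : LinearMap.range (linearDifferential ε j₁ j₂ (k + 1) k) ≤
      LinearMap.ker (linearDifferential ε j₁ j₂ k (k - 1))) :
    betti ε j₁ j₂ k + Module.finrank (ZMod 2)
        (LinearMap.range (linearDifferential ε j₁ j₂ (k + 1) k)) +
      Module.finrank (ZMod 2) (LinearMap.range (linearDifferential ε j₁ j₂ k (k - 1))) =
      Nat.card (SplitVertex W j₁ j₂ k) := by
  classical
  -- Rank–nullity for the outgoing differential and for the quotient; since the image lies in the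
  -- kernel, it enters with its full rank.
  have h1 := Submodule.finrank_quotient_add_finrank
    ((LinearMap.range (linearDifferential ε j₁ j₂ (k + 1) k)).submoduleOf
        (LinearMap.ker (linearDifferential ε j₁ j₂ k (k - 1))))
  rw [LinearEquiv.finrank_eq (Submodule.submoduleOfEquivOfLe h)] at h1
  have h2 := LinearMap.finrank_range_add_finrank_ker (linearDifferential ε j₁ j₂ k (k - 1))
  rw [Module.finrank_fintype_fun_eq_card, ← Nat.card_eq_fintype_card] at h2
  rw [betti]
  omega

end

/-! ### Poincaré–Chekanov polynomials -/

open LaurentPolynomial in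
theorem finsum_card_mul_T {V : Type*} [Finite V] (P : V → Prop) [DecidablePred P] (f : V → ℤ) :
    (Function.support fun k : ℤ => (C (Nat.card {a // P a ∧ f a = k} : ℤ) * T k :
      LaurentPolynomial ℤ)).Finite ∧
    ∑ᶠ k : ℤ, (C (Nat.card {a // P a ∧ f a = k} : ℤ) * T k : LaurentPolynomial ℤ) =
      ∑ᶠ a, if P a then T (f a) else 0 := by
  classical
  have := Fintype.ofFinite V
  have hs : (Function.support fun k : ℤ => (C (Nat.card {a // P a ∧ f a = k} : ℤ) * T k :
      LaurentPolynomial ℤ)) ⊆ ((Finset.univ.filter P).image f : Finset ℤ) := by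
    intro k hk
    by_contra hne
    apply hk
    have : IsEmpty {a // P a ∧ f a = k} :=
      ⟨fun a => hne (by
        simp only [Finset.coe_image, Set.mem_image]
        exact ⟨a.1, by simp [a.2.1], a.2.2⟩)⟩
    simp
  refine ⟨(Finset.finite_toSet _).subset hs, ?_⟩
  rw [finsum_eq_sum_of_support_subset _ hs, finsum_eq_sum_of_fintype, ← Finset.sum_filter,
    Finset.sum_comp T f]
  refine Finset.sum_congr rfl fun k _ => ?_
  rw [Nat.card_eq_fintype_card, Fintype.card_subtype, Finset.filter_filter, nsmul_eq_mul]
  simp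

/-- Arcs contribute zero, so a sum over vertices may be taken over the whole list of sites. -/
theorem finsum_vertex {M : Type*} [AddCommMonoid M] {K : List Site} (f : Site → M)
    (hf : ∀ κ, κ.letter.isCross = false → f κ = 0) :
    ∑ᶠ a : Vertex (siteWord K), f (siteOf a) = (K.map f).sum := by
  classical
  rw [finsum_eq_sum_of_fintype, ← Fin.sum_univ_fun_getElem]
  have e : K.length = (siteWord K).length := by simp
  rw [← Equiv.sum_comp (finCongr e).symm]
  let g : Fin (siteWord K).length → M := fun s => f (K[(s : ℕ)]'(by simpa using s.2))
  have h1 : ∑ s, g s = ∑ s with ((siteWord K).get s).isCross = true, g s := by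
    rw [Finset.sum_filter]
    refine Finset.sum_congr rfl fun s _ => ?_
    split_ifs with h
    · rfl
    · exact hf _ (by simpa using h)
  have h2 : ∑ s with ((siteWord K).get s).isCross = true, g s =
      ∑ a : Vertex (siteWord K), g a.1 :=
    Finset.sum_subtype _ (by simp) _
  exact (h1.trans h2).symm

namespace IsClosed

variable {K : List Site} (hK : IsClosed K)
include hK

open LaurentPolynomial in
theorem finsum_card_splitVertex {j₁ j₂ : Fin 2} (hj : j₁ ≠ j₂) :
    (Function.support fun k : ℤ => (C (Nat.card (SplitVertex (siteWord K) j₁ j₂ k) : ℤ) * T k :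
      LaurentPolynomial ℤ)).Finite ∧
    ∑ᶠ k : ℤ, (C (Nat.card (SplitVertex (siteWord K) j₁ j₂ k) : ℤ) * T k : LaurentPolynomial ℤ) =
      (K.map fun κ => if κ.overComp = j₁ ∧ κ.underComp = j₂ then T κ.deg else 0).sum := by
  have h := finsum_card_mul_T (fun a : Vertex (siteWord K) => (siteOf a).overComp = j₁ ∧
    (siteOf a).underComp = j₂) fun a => (siteOf a).deg
  have e : ∀ k : ℤ, SplitVertex (siteWord K) j₁ j₂ k = {a : Vertex (siteWord K) //
      ((siteOf a).overComp = j₁ ∧ (siteOf a).underComp = j₂) ∧ (siteOf a).deg = k} := by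
    intro k
    simp only [SplitVertex, hK.inSplit_iff, hK.degree_eq]
  simp only [e]
  refine ⟨h.1, h.2.trans (finsum_vertex (fun κ : Site =>
    if κ.overComp = j₁ ∧ κ.underComp = j₂ then (T κ.deg : LaurentPolynomial ℤ) else 0) ?_)⟩
  intro κ hκ
  cases κ <;> simp only [Site.letter, Letter.isCross, Bool.true_eq_false] at hκ
  -- Both components of an arc have the default value `0` and cannot match two different ones.
  · exact if_neg fun h => hj (h.1.symm.trans h.2)
  · exact if_neg fun h => hj (h.1.symm.trans h.2)

omit hK in
theorem comp_ne_of_inSplit {hK : IsClosed K} {j₁ j₂ : Fin 2} (hj : j₁ ≠ j₂)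
    {a : Vertex (siteWord K)} (h : InSplit j₁ j₂ a) :
    (siteOf a).overComp ≠ (siteOf a).underComp := by
  rw [hK.inSplit_iff] at h
  rw [h.1, h.2]; exact hj

/-- Only the even crossings of the twists lie in `𝔸¹²`, and their disk sums vanish. -/
theorem linearCoeff_split_zero_one {a c : Vertex (siteWord K)} (ha : InSplit 0 1 a)
    (hc : InSplit 0 1 c) : linearCoeff linkAug c a = 0 := by
  have hc' := comp_ne_of_inSplit (hK := hK) (by simp) hc
  rw [hK.inSplit_iff] at ha
  obtain ⟨p, hp⟩ : ∃ p, siteOf a = .even p := by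
    generalize siteOf a = κ at *
    cases κ <;> simp_all [Site.overComp, Site.underComp]
  exact hK.linearCoeff_even hc' hp

open LaurentPolynomial in
theorem chekanovPoly_linkAug {j₁ j₂ : Fin 2} (hj : j₁ ≠ j₂)
    (h : ∀ a c : Vertex (siteWord K), InSplit j₁ j₂ a → InSplit j₁ j₂ c →
      linearCoeff linkAug c a = 0) :
    chekanovPoly (linkAug : Vertex (siteWord K) → ZMod 2) j₁ j₂ =
      (K.map fun κ => if κ.overComp = j₁ ∧ κ.underComp = j₂ then T κ.deg else 0).sum := by
  rw [← (hK.finsum_card_splitVertex hj).2, chekanovPoly]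
  refine finsum_congr fun k => ?_
  have h0 : ∀ k l, linearDifferential (linkAug : Vertex (siteWord K) → ZMod 2) j₁ j₂ k l = 0 :=
    fun k l => linearDifferential_eq_zero fun a c ha hc _ _ => h a c ha hc
  have h1 := betti_add (ε := (linkAug : Vertex (siteWord K) → ZMod 2)) (j₁ := j₁) (j₂ := j₂) k
    (by rw [h0, h0]; simp)
  rw [h0, h0, LinearMap.range_zero, LinearMap.range_zero, finrank_bot, finrank_bot] at h1
  rw [← h1, add_zero, add_zero]

/-- The linearized differential of `𝔸²¹` is trivial if there are no twists in level zero. -/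
theorem linearCoeff_split_one_zero {a c : Vertex (siteWord K)} (ha : InSplit 1 0 a)
    (hc : InSplit 1 0 c) (h0 : .even 0 ∉ K) : linearCoeff linkAug c a = 0 := by
  obtain ⟨b, hb⟩ := hK.exists_special
  have hc' := comp_ne_of_inSplit (hK := hK) (by simp) hc
  rw [hK.inSplit_iff] at ha
  have h3 := getElem?_vertex a
  rcases h : siteOf a with _ | p | _ | _ | _ | _ | _ | _ <;>
    simp only [h, Site.overComp, Site.underComp, false_and, and_true, zero_ne_one] at ha
  · by_contra hne
    obtain ⟨rfl, -⟩ := hK.linearCoeff_odd hc' hb h hne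
    rw [h] at h3
    obtain ⟨κ, h4, rfl⟩ := hK.next _ _ h3
    exact h0 (List.mem_of_getElem? h4)
  · exact hK.linearCoeff_last_of_notMem hc' hb h h0
  · exact hK.linearCoeff_special h

theorem add_two_of_getElem?_last {s : ℕ} (hs : K[s]? = some .last) : s + 2 = K.length := by
  have h1 := (List.getElem?_eq_some_iff.mp hs).1
  have h2 : s + 1 < K.length := by
    by_contra h2
    have := (hK.special_iff s).2 (by omega)
    simp [hs] at this
  obtain ⟨κ, h3, rfl⟩ := hK.next _ _ hs
  rw [nextCol_eq h2, hK.special_iff] at h3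
  exact h3

theorem linearCoeff_split_one_zero_ne {a c b : Vertex (siteWord K)} (ha : InSplit 1 0 a)
    (hc : InSplit 1 0 c) (hb : siteOf b = .special) (hne : linearCoeff linkAug c a ≠ 0) {s : ℕ}
    (hs : K[s]? = some (.even 0)) (hs' : K[s + 1]? = some .last) :
    degree a = 0 ∧ c = b := by
  classical
  have hc' := comp_ne_of_inSplit (hK := hK) (by simp) hc
  rw [hK.degree_eq]
  rw [hK.inSplit_iff] at ha
  have h3 := getElem?_vertex a
  rcases h : siteOf a with _ | p | _ | _ | _ | _ | _ | _ <;>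
    simp only [h, Site.overComp, Site.underComp, false_and, and_true, zero_ne_one] at ha
  · obtain ⟨rfl, hcb⟩ := hK.linearCoeff_odd hc' hb h hne
    exact ⟨by simp [Site.deg], hcb⟩
  · refine ⟨by simp [Site.deg], ?_⟩
    rw [h] at h3
    -- `last` can stand only in the last place but one, so `a` is the crossing right after the twist
    -- at `s`.
    have h1 := hK.add_two_of_getElem?_last h3
    have h2 := hK.add_two_of_getElem?_last hs'
    rw [hK.linearCoeff_last_of_even hc' hb h hs (by omega)] at hne
    by_contra hcb
    exact hne (if_neg fun e => hcb e.symm)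
  · exact absurd (hK.linearCoeff_special h) hne

/-- The only differential of `𝔸²¹` in the presence of twists in level zero: its image is spanned by
the special crossing. -/
theorem finrank_range_linearDifferential {s : ℕ} (hs : K[s]? = some (.even 0))
    (hs' : K[s + 1]? = some .last) :
    Module.finrank (ZMod 2) (LinearMap.range
      (linearDifferential (linkAug : Vertex (siteWord K) → ZMod 2) 1 0 0 (-1))) = 1 := by
  classical
  obtain ⟨b, hb⟩ := hK.exists_special
  have hw : (siteWord K)[s + 1]? = some (.cross 0 .normal) := by simp [hs', Site.letter]
  have ha : siteOf (mkVertex hw) = .last := siteOf_mkVertex hs' hw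
  have hb1 : InSplit 1 0 b := by rw [hK.inSplit_iff, hb]; exact ⟨rfl, rfl⟩
  have ha1 : InSplit 1 0 (mkVertex hw) := by rw [hK.inSplit_iff, ha]; exact ⟨rfl, rfl⟩
  let a' : SplitVertex (siteWord K) 1 0 0 := ⟨mkVertex hw, ha1, by rw [hK.degree_eq, ha]; rfl⟩
  let b' : SplitVertex (siteWord K) 1 0 (-1) := ⟨b, hb1, by rw [hK.degree_eq, hb]; rfl⟩
  have key : LinearMap.range
      (linearDifferential (linkAug : Vertex (siteWord K) → ZMod 2) 1 0 0 (-1)) =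
      Submodule.span (ZMod 2) {Pi.single b' 1} := by
    refine le_antisymm ?_ ?_
    · rintro _ ⟨x, rfl⟩
      rw [Submodule.mem_span_singleton]
      -- The scalar is the coordinate at the special crossing; all other coordinates of the image
      -- are zero.
      refine ⟨linearDifferential linkAug 1 0 0 (-1) x b', ?_⟩
      funext c
      by_cases hcb : c = b'
      · subst hcb; simp
      · rw [Pi.smul_apply, Pi.single_eq_of_ne hcb, smul_zero, linearDifferential,
          Matrix.mulVecLin_apply, Matrix.mulVec, dotProduct]
        refine (Finset.sum_eq_zero fun a _ => ?_).symm
        have : linearCoeff linkAug c.1 a.1 = 0 := by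
          by_contra hne
          exact hcb (Subtype.ext
            (hK.linearCoeff_split_one_zero_ne a.2.1 c.2.1 hb hne hs hs').2)
        rw [Matrix.of_apply, this, zero_mul]
    · rw [Submodule.span_singleton_le_iff_mem]
      refine ⟨Pi.single a' 1, ?_⟩
      rw [linearDifferential, Matrix.mulVecLin_apply, Matrix.mulVec_single_one]
      funext c
      rw [Matrix.col_apply, Matrix.of_apply,
        hK.linearCoeff_last_of_even (comp_ne_of_inSplit (hK := hK) (by simp) c.2.1) hb ha hs rfl]
      by_cases hcb : c = b'
      · subst hcb; simp [b']
      · rw [Pi.single_eq_of_ne hcb, if_neg fun e => hcb (Subtype.ext e.symm)]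
  rw [key, finrank_span_singleton]
  intro h0
  have := congrFun h0 b'
  simp at this

-- One differential of rank one, from degree `0` to degree `-1`, removes a class in each of these
-- degrees. The additive form avoids subtracting natural numbers.
open LaurentPolynomial in
theorem chiMinus_linkAug_add {s : ℕ} (hs : K[s]? = some (.even 0))
    (hs' : K[s + 1]? = some .last) :
    chiMinus (linkAug : Vertex (siteWord K) → ZMod 2) + (T (-1) + 1) =
      (K.map fun κ => if κ.overComp = 1 ∧ κ.underComp = 0 then T κ.deg else 0).sum := by
  obtain ⟨hfin, hsum⟩ := hK.finsum_card_splitVertex (j₁ := 1) (j₂ := 0) (by simp)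
  rw [← hsum, chiMinus, chekanovPoly]
  have h0 : ∀ k l, k ≠ 0 →
      linearDifferential (linkAug : Vertex (siteWord K) → ZMod 2) 1 0 k l = 0 := by
    refine fun k l hk => linearDifferential_eq_zero fun a c ha hc hak _ => ?_
    by_contra hne
    obtain ⟨b, hb⟩ := hK.exists_special
    exact hk (hak.symm.trans (hK.linearCoeff_split_one_zero_ne ha hc hb hne hs hs').1)
  have hr := hK.finrank_range_linearDifferential hs hs'
  have hbetti : ∀ k : ℤ, Nat.card (SplitVertex (siteWord K) 1 0 k) =
      betti (linkAug : Vertex (siteWord K) → ZMod 2) 1 0 k +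
        ((if k = -1 then 1 else 0) + if k = 0 then 1 else 0) := by
    intro k
    have h1 := betti_add (ε := (linkAug : Vertex (siteWord K) → ZMod 2)) (j₁ := 1) (j₂ := 0) k
    by_cases hk0 : k = 0
    · subst hk0
      rw [zero_add, zero_sub, h0 1 0 one_ne_zero, hr, LinearMap.range_zero, finrank_bot] at h1
      rw [← h1 bot_le]
      simp
    · rw [h0 k _ hk0, LinearMap.range_zero, finrank_bot, LinearMap.ker_zero] at h1
      rw [← h1 le_top, if_neg hk0]
      by_cases hk1 : k = -1
      · subst hk1
        rw [neg_add_cancel, hr]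
        simp
      · rw [h0 (k + 1) k (by omega), LinearMap.range_zero, finrank_bot, if_neg hk1]
  have hterm : ∀ k : ℤ, (C (Nat.card (SplitVertex (siteWord K) 1 0 k) : ℤ) * T k :
      LaurentPolynomial ℤ) =
      C (betti (linkAug : Vertex (siteWord K) → ZMod 2) 1 0 k : ℤ) * T k +
        ((if k = -1 then T (-1) else 0) + if k = 0 then 1 else 0) := by
    intro k
    rw [hbetti]
    split_ifs with h1 h2 h2
    · omega
    · subst h1; simp [add_mul]
    · subst h2; simp
    · simp
  simp only [hterm]
  have hA : (Function.support fun k : ℤ =>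
      (if k = -1 then T (-1) else 0 : LaurentPolynomial ℤ)).Finite :=
    (Set.finite_singleton (-1)).subset fun k hk => by
      by_contra hne; exact hk (if_neg hne)
  have hB : (Function.support fun k : ℤ => (if k = 0 then 1 else 0 : LaurentPolynomial ℤ)).Finite :=
    (Set.finite_singleton 0).subset fun k hk => by
      by_contra hne; exact hk (if_neg hne)
  have hC : (Function.support fun k : ℤ => (C (betti (linkAug : Vertex (siteWord K) → ZMod 2)
      1 0 k : ℤ) * T k : LaurentPolynomial ℤ)).Finite := by
    refine hfin.subset fun k hk hne => hk ?_
    have h1 : betti (linkAug : Vertex (siteWord K) → ZMod 2) 1 0 k = 0 := by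
      have h2 : Nat.card (SplitVertex (siteWord K) 1 0 k) = 0 := by
        have h3 := ((isUnit_T k).mul_left_eq_zero).mp hne
        -- Evaluation at `λ = 1` recovers the integer from the constant polynomial.
        have h4 := congrArg (fun x : LaurentPolynomial ℤ => eval₂ (RingHom.id ℤ) 1 x) h3
        simpa using h4
      have := hbetti k
      omega
    simp [h1]
  rw [finsum_add_distrib hC ((hA.union hB).subset (Function.support_add _ _)),
    finsum_add_distrib hA hB, finsum_eq_single _ (-1) fun k hk => if_neg hk,
    finsum_eq_single _ 0 fun k hk => if_neg hk, if_pos rfl, if_pos rfl]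

end IsClosed

/-! ### The generators of the standard links -/

theorem sum_map_twistSites {M : Type*} [AddCommMonoid M] (f : Site → M) (p g : ℕ) :
    ((twistSites p g).map f).sum = g • (f (.odd p) + f (.even p)) := by
  induction g with
  | zero => simp [twistSites]
  | succ g ih => rw [succ_nsmul', ← ih]; simp [twistSites, add_assoc]

theorem sum_map_levelSites {M : Type*} [AddCommMonoid M] (f : Site → M)
    (hv : ∀ p, f (.vert p) = 0) (hl : ∀ p, f (.loop p) = 0) (hc : ∀ p, f (.cap p) = 0)
    (G : ℕ → ℕ) (N : ℕ) :
    ((levelSites G N).map f).sum =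
      ∑ p ∈ Finset.range (N + 1), G p • (f (.odd p) + f (.even p)) := by
  induction N with
  | zero => simp [levelSites, sum_map_twistSites]
  | succ N ih =>
    rw [Finset.sum_range_succ, ← ih]
    simp [levelSites, sum_map_twistSites, hv, hl, hc, add_comm]

theorem sum_map_sites {M : Type*} [AddCommMonoid M] (f : Site → M) (hu : ∀ q, f (.cup q) = 0)
    (hv : ∀ p, f (.vert p) = 0) (hl : ∀ p, f (.loop p) = 0) (hc : ∀ p, f (.cap p) = 0)
    (G : ℕ → ℕ) (N : ℕ) :
    ((sites G N).map f).sum =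
      ∑ p ∈ Finset.range (N + 1), G p • (f (.odd p) + f (.even p)) +
        (f .last + f .special) := by
  have h : (((List.range N).map Site.cup).map f).sum = 0 :=
    List.sum_eq_zero fun x hx => by
      simp only [List.map_map, List.mem_map] at hx
      obtain ⟨q, -, rfl⟩ := hx
      exact hu q
  rw [sites, List.map_append, List.sum_append, h, zero_add, List.map_append, List.sum_append,
    sum_map_levelSites f hv hl hc]
  simp

open LaurentPolynomial in
theorem sum_sites_zero_one (G : ℕ → ℕ) (N : ℕ) :
    ((sites G N).map fun κ => if κ.overComp = 0 ∧ κ.underComp = 1 then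
      (T κ.deg : LaurentPolynomial ℤ) else 0).sum = twistPoly G N := by
  rw [sum_map_sites] <;> simp [Site.overComp, Site.underComp, Site.deg, twistPoly]

-- The odd crossings of level `p` give `λ ^ (-p)`; the terms `λ⁻¹` and `1` are the special crossing
-- and `last`.
open LaurentPolynomial in
theorem sum_sites_one_zero (G : ℕ → ℕ) (N : ℕ) :
    ((sites G N).map fun κ => if κ.overComp = 1 ∧ κ.underComp = 0 then
      (T κ.deg : LaurentPolynomial ℤ) else 0).sum =
      T (-1) + 1 + invert (twistPoly G N) := by
  rw [sum_map_sites] <;> simp [Site.overComp, Site.underComp, Site.deg, twistPoly]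
  ring

theorem even_zero_notMem_twistSites {p g : ℕ} (h : p ≠ 0 ∨ g = 0) :
    Site.even 0 ∉ twistSites p g := by
  induction g with
  | zero => simp [twistSites]
  | succ g ih =>
    have hp : p ≠ 0 := by simpa using h
    simpa [twistSites, Ne.symm hp] using ih (.inl hp)

theorem even_zero_notMem_sites {G : ℕ → ℕ} (h : G 0 = 0) (N : ℕ) : Site.even 0 ∉ sites G N := by
  have : Site.even 0 ∉ levelSites G N := by
    induction N with
    | zero => exact even_zero_notMem_twistSites (.inr h)
    | succ N ih =>
      simp [levelSites, ih, even_zero_notMem_twistSites (p := N + 1) (.inl (by simp))]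
  simp [sites, this]

theorem twistSites_succ' (p g : ℕ) :
    twistSites p (g + 1) = twistSites p g ++ [.odd p, .even p] := by
  induction g with
  | zero => rfl
  | succ g ih =>
    conv_lhs => rw [twistSites, ih]
    rfl

/-- Level zero comes last and every full twist ends with an even crossing, so a nonempty level zero
puts one directly before `last`. -/
theorem exists_getElem?_sites {G : ℕ → ℕ} (h : G 0 ≠ 0) (N : ℕ) :
    ∃ s, (sites G N)[s]? = some (.even 0) ∧ (sites G N)[s + 1]? = some .last := by
  obtain ⟨r, hr⟩ : ∃ r, levelSites G N = r ++ [.even 0] := by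
    induction N with
    | zero =>
      obtain ⟨g, hg⟩ := Nat.exists_eq_succ_of_ne_zero h
      exact ⟨twistSites 0 g ++ [.odd 0], by rw [levelSites, hg, twistSites_succ']; simp⟩
    | succ N ih =>
      obtain ⟨r, hr⟩ := ih
      exact ⟨_, by rw [levelSites, hr, ← List.cons_append, ← List.cons_append,
        ← List.cons_append, ← List.append_assoc]⟩
  have e : sites G N = ((List.range N).map .cup ++ r) ++ [.even 0, .last, .special] := by
    simp [sites, hr]
  refine ⟨((List.range N).map Site.cup ++ r).length, ?_, ?_⟩
  · rw [e, List.getElem?_append_right le_rfl]; simp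
  · rw [e, List.getElem?_append_right (by omega)]; simp

theorem exists_augmentation_sites (G : ℕ → ℕ) (N : ℕ) :
    (∀ a : Vertex (siteWord (sites G N)), Finite (Disk _ a) ∧ ∃! d, HasDegree a d) ∧
    ∃ ε : Vertex (siteWord (sites G N)) → ZMod 2, IsAugmentation ε ∧
      (∀ ε', IsAugmentation ε' → ε' = ε) ∧ chiPlus ε = twistPoly G N ∧
      chiMinus ε = if 1 ≤ G 0 then LaurentPolynomial.invert (chiPlus ε)
        else LaurentPolynomial.T (-1) + 1 + LaurentPolynomial.invert (chiPlus ε) := by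
  have hK := isClosed_sites G N
  refine ⟨fun a => ⟨hK.finite_disk a, _, (hK.hasDegree_iff a _).2 rfl,
    fun d hd => (hK.hasDegree_iff a d).1 hd⟩, linkAug, hK.isAugmentation_linkAug,
    fun ε' h => hK.eq_linkAug h, ?_⟩
  have hplus : chiPlus (linkAug : Vertex (siteWord (sites G N)) → ZMod 2) = twistPoly G N :=
    (hK.chekanovPoly_linkAug (by simp) fun a c ha hc =>
      hK.linearCoeff_split_zero_one ha hc).trans (sum_sites_zero_one G N)
  refine ⟨hplus, ?_⟩
  rw [hplus]
  split_ifs with h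
  · obtain ⟨s, hs, hs'⟩ := exists_getElem?_sites (G := G) (by omega) N
    have := hK.chiMinus_linkAug_add hs hs'
    rw [sum_sites_one_zero, add_comm] at this
    -- The rank-one differential removes exactly the summand `λ⁻¹ + 1` contributed by the transition
    -- tangle.
    exact add_left_cancel this
  · exact (hK.chekanovPoly_linkAug (by simp) fun a c ha hc =>
      hK.linearCoeff_split_one_zero ha hc (even_zero_notMem_sites (by omega) N)).trans
      (sum_sites_one_zero G N)

end LegendrianSolidTorus

/-! ### The theorem for the standard rational links. -/

theorem mainTheorem1 (n : ℕ) (hn : 1 ≤ n) (h v : ℕ → ℕ)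
    (hh : ∀ i, 2 ≤ i → i ≤ n → 1 ≤ h i) (hv : ∀ i, 1 ≤ i → i < n → 1 ≤ v i) :
    (∀ a : LegendrianSolidTorus.Vertex (LegendrianSolidTorus.standardLink n h v),
      Finite (LegendrianSolidTorus.Disk _ a) ∧ ∃! d, LegendrianSolidTorus.HasDegree a d) ∧
    ∃ ε : LegendrianSolidTorus.Vertex (LegendrianSolidTorus.standardLink n h v) → ZMod 2,
      LegendrianSolidTorus.IsAugmentation ε ∧
      (∀ ε', LegendrianSolidTorus.IsAugmentation ε' → ε' = ε) ∧
      LegendrianSolidTorus.chiPlus ε =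
        ∑ i ∈ Finset.Icc 1 n, LaurentPolynomial.C (h i : ℤ) *
          LaurentPolynomial.T (∑ k ∈ Finset.Ico 1 i, (v k : ℤ)) ∧
      LegendrianSolidTorus.chiMinus ε =
        if 1 ≤ h 1 then LaurentPolynomial.invert (LegendrianSolidTorus.chiPlus ε)
        else LaurentPolynomial.T (-1) + 1 +
          LaurentPolynomial.invert (LegendrianSolidTorus.chiPlus ε) := by
  obtain ⟨G, N, h1, h2, h3⟩ := LegendrianSolidTorus.standardTangle_eq_frontStandard h v (n - 1) 1
    fun k hk hk' => hv k hk (by omega)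
  have hW : LegendrianSolidTorus.standardLink n h v =
      LegendrianSolidTorus.siteWord (LegendrianSolidTorus.sites G N) := by
    rw [LegendrianSolidTorus.standardLink, h1, LegendrianSolidTorus.resolution_frontStandard]
  rw [Nat.add_sub_cancel' hn] at h3
  have key := LegendrianSolidTorus.exists_augmentation_sites G N
  rw [h2, h3, ← hW] at key
  exact key
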